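/- Let $\Bbbk$ be a field, let $\tau\in\Bbbk$ be such that $x^2+\tau$ is irreducible over $\Bbbk$, let $\mathbb F=\Bbbk[x]/(x^2+\tau)$ with $\xi$ the class of $x$, and let $n\ge 2$. Every $Z\in M_n(\mathbb F)$ is uniquely $Z=A+\xi B$ with $A,B\in M_n(\Bbbk)$. Put $$\mathcal S_1=\{A+\xi B\in \mathrm{GL}_n(\mathbb F): A,\ A+\tau BA^{-1}B\in \mathrm{GL}_n(\Bbbk)\},\qquad \mathcal S_2=\{A+\xi B\in \mathrm{GL}_n(\mathbb F): B,\ \tau B+AB^{-1}A\in \mathrm{GL}_n(\Bbbk)\}.$$ A straight-line program is a finite sequence of instructions whose operands are the inputs $A,B$ or results of earlier instructions. The instructions are: a scalar matrix $cI_n$, a scalar multiple $cX$ ($c\in\Bbbk$), a sum $X+Y$, a product $XY$, and an inverse $X^{-1}$ in $M_n(\Bbbk)$, the last being defined only if $X\in\mathrm{GL}_n(\Bbbk)$; two of the matrices at hand (inputs or results) are its outputs. It inverts a set $\mathcal S\subseteq \mathrm{GL}_n(\mathbb F)$ if for every $Z=A+\xi B\in\mathcal S$ all its instructions are defined on the input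 $(A,B)$ and its outputs are the $C,D\in M_n(\Bbbk)$ with $Z^{-1}=C+\xi D$. Sums, products and inverses are counted; scalar matrices and scalar multiples are free. Frobenius inversion takes $Z=A+\xi B\in\mathcal S_1\cup\mathcal S_2$ and sets $(X,Y,\tau_1,\tau_2)=(A,B,1,\tau)$ if $Z\in\mathcal S_1$, and $(X,Y,\tau_1,\tau_2)=(B,A,\tau,1)$ otherwise. It computes $X^{-1}$, $X^{-1}Y$, $YX^{-1}Y$, $\tau_1X+\tau_2YX^{-1}Y$, $J=(\tau_1X+\tau_2YX^{-1}Y)^{-1}$ and $K=X^{-1}YJ$, and returns $J-\xi K$ in the first case and $K-\xi J$ in the second. Then Frobenius inversion returns $Z^{-1}$ for every $Z\in\mathcal S_1\cup\mathcal S_2$; its first branch is a straight-line program that inverts $\mathcal S_1$ and its second branch is one that inverts $\mathcal S_2$; and each branch uses exactly two inversions, three multiplications and one addition in $M_n(\Bbbk)$. Moreover, it is optimal: every straight-line program that inverts $\mathcal S_1$, and every one that inverts $\mathcal S_2$ (in particular every one that inverts $\mathcal S_1\cup\mathcal S_2$), uses at least five multiplications and inversions in total, and at least one addition. -/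

import Mathlib

open Polynomial

noncomputable section

namespace Frobenius

/-! ### Straight-line programs over a `k`-algebra -/

/-- An instruction of a straight-line program with scalars in `k`. The natural numbers are the
indices of registers that hold the inputs and the results of earlier instructions. Constants mean
scalar multiples of the identity. -/
inductive Instr (k : Type*) where
  | const (c : k)
  | smul (c : k) (i : ℕ)
  | add (i j : ℕ)
  | mul (i j : ℕ)
  | inv (i : ℕ)

/-- `I.Yields s x`: executed on the list `s` of registers, the instruction `I` is defined and its
result is `x`. An inversion is defined exactly when its operand is invertible in `R`. -/
def Instr.Yields {k R : Type*} [Field k] [Ring R] [Algebra k R] : Instr k → List R → R → Prop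
  | .const c, _, x => x = algebraMap k R c
  | .smul c i, s, x => ∃ y, s[i]? = some y ∧ x = c • y
  | .add i j, s, x => ∃ y z, s[i]? = some y ∧ s[j]? = some z ∧ x = y + z
  | .mul i j, s, x => ∃ y z, s[i]? = some y ∧ s[j]? = some z ∧ x = y * z
  | .inv i, s, x => ∃ y, s[i]? = some y ∧ y * x = 1 ∧ x * y = 1

/-- `Exec L s t`: starting from the registers `s`, all instructions of `L` are defined when they
are executed in order, each appending its result as a new register, and the final list of
registers is `t`. -/
def Exec {k R : Type*} [Field k] [Ring R] [Algebra k R] : List (Instr k) → List R → List R → Prop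
  | [], s, t => t = s
  | I :: L, s, t => ∃ x, I.Yields s x ∧ Exec L (s ++ [x]) t

/-- A straight-line program with two inputs (registers `0` and `1`) and two outputs. -/
structure Program (k : Type*) where
  code : List (Instr k)
  out₀ : ℕ
  out₁ : ℕ

/-- On the input `(a, b)` the program is defined and its output is `(c, d)`. -/
def Program.Computes {k R : Type*} [Field k] [Ring R] [Algebra k R] (Γ : Program k)
    (a b c d : R) : Prop :=
  ∃ t : List R, Exec Γ.code [a, b] t ∧ t[Γ.out₀]? = some c ∧ t[Γ.out₁]? = some d

def Instr.isMul {k : Type*} : Instr k → Bool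
  | .mul _ _ => true
  | _ => false

def Instr.isInv {k : Type*} : Instr k → Bool
  | .inv _ => true
  | _ => false

def Instr.isAdd {k : Type*} : Instr k → Bool
  | .add _ _ => true
  | _ => false

/-- Number of multiplications (multiplications by scalars of `k` are not counted). -/
def Program.muls {k : Type*} (Γ : Program k) : ℕ := Γ.code.countP Instr.isMul

/-- Number of inversions. -/
def Program.invs {k : Type*} (Γ : Program k) : ℕ := Γ.code.countP Instr.isInv

/-- Number of additions. -/
def Program.adds {k : Type*} (Γ : Program k) : ℕ := Γ.code.countP Instr.isAdd

/-! ### The quadratic extension and the domains of inversion -/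

/-- `F = k[x]/(x² + τ)`. -/
abbrev QuadExt {k : Type*} [Field k] (τ : k) : Type _ := AdjoinRoot (X ^ 2 + C τ : k[X])

/-- The matrix `A + ξ B` over `F = k[x]/(x² + τ)`, where `ξ` is the class of `x`. -/
def complexify {k : Type*} [Field k] (τ : k) {n : ℕ} (A B : Matrix (Fin n) (Fin n) k) :
    Matrix (Fin n) (Fin n) (QuadExt τ) :=
  A.map (AdjoinRoot.of (X ^ 2 + C τ : k[X])) +
    AdjoinRoot.root (X ^ 2 + C τ : k[X]) • B.map (AdjoinRoot.of (X ^ 2 + C τ : k[X]))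

/-- `S₁ = {A + ξ B ∈ GL_n(F) : A, A + τ B A⁻¹ B ∈ GL_n(k)}`. -/
def S₁ {k : Type*} [Field k] (τ : k) (n : ℕ) : Set (Matrix (Fin n) (Fin n) (QuadExt τ)) :=
  {Z | ∃ A B : Matrix (Fin n) (Fin n) k, Z = complexify τ A B ∧ IsUnit Z ∧
    IsUnit A ∧ IsUnit (A + τ • (B * A⁻¹ * B))}

/-- `S₂ = {A + ξ B ∈ GL_n(F) : B, τ B + A B⁻¹ A ∈ GL_n(k)}`. -/
def S₂ {k : Type*} [Field k] (τ : k) (n : ℕ) : Set (Matrix (Fin n) (Fin n) (QuadExt τ)) :=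
  {Z | ∃ A B : Matrix (Fin n) (Fin n) k, Z = complexify τ A B ∧ IsUnit Z ∧
    IsUnit B ∧ IsUnit (τ • B + A * B⁻¹ * A)}

/-- The program `Γ`, run over `M_n(k)` on the two `k`-components `A`, `B` of `Z = A + ξ B`, is
defined and outputs the two `k`-components of `Z⁻¹`. -/
def Program.InvertsAt {k : Type*} [Field k] {τ : k} {n : ℕ} (Γ : Program k)
    (Z : Matrix (Fin n) (Fin n) (QuadExt τ)) : Prop :=
  ∃ A B U V : Matrix (Fin n) (Fin n) k,
    Z = complexify τ A B ∧ Z⁻¹ = complexify τ U V ∧ Γ.Computes A B U V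

/-- `Γ` inverts every member of `S`. -/
def Program.InvertsOn {k : Type*} [Field k] {τ : k} {n : ℕ} (Γ : Program k)
    (S : Set (Matrix (Fin n) (Fin n) (QuadExt τ))) : Prop :=
  ∀ Z ∈ S, Γ.InvertsAt Z

/-! ### Frobenius inversion -/

/-- The common body of the two branches of Frobenius inversion. Here `X`, `Y` are the registers
`x`, `y`, and the last instruction changes the sign of register `r`. -/
def frobeniusCode {k : Type*} [Field k] (x y : ℕ) (τ₁ τ₂ : k) (r : ℕ) : List (Instr k) :=
  [ .inv x,       -- 2 : X⁻¹
    .mul 2 y,     -- 3 : X⁻¹ Y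
    .mul y 3,     -- 4 : Y X⁻¹ Y
    .smul τ₁ x,   -- 5 : τ₁ X
    .smul τ₂ 4,   -- 6 : τ₂ Y X⁻¹ Y
    .add 5 6,     -- 7 : τ₁ X + τ₂ Y X⁻¹ Y
    .inv 7,       -- 8 : J = (τ₁ X + τ₂ Y X⁻¹ Y)⁻¹
    .mul 3 8,     -- 9 : K = X⁻¹ Y J
    .smul (-1) r ]

/-- The branch for `S₁`: `X = A`, `Y = B`, `τ₁ = 1`, `τ₂ = τ`, and the output is `J - ξ K`. -/
def frobenius₁ {k : Type*} [Field k] (τ : k) : Program k := ⟨frobeniusCode 0 1 1 τ 9, 8, 10⟩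

/-- The branch for `S₂`: `X = B`, `Y = A`, `τ₁ = τ`, `τ₂ = 1`, and the output is `K - ξ J`. -/
def frobenius₂ {k : Type*} [Field k] (τ : k) : Program k := ⟨frobeniusCode 1 0 τ 1 8, 9, 10⟩

open Classical in
/-- Frobenius inversion: the straight-line program that is run on the input `Z`. -/
def frobeniusInversion {k : Type*} [Field k] (τ : k) {n : ℕ}
    (Z : Matrix (Fin n) (Fin n) (QuadExt τ)) : Program k :=
  if Z ∈ S₁ τ n then frobenius₁ τ else frobenius₂ τ

end Frobenius

end

/-!
A program that inverts `S₁` can be run on all inputs at once, in the algebra of matrix-valued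
functions of the input `(A, B)`; multiplication by `ξ` turns a program for `S₂` into this case. The
span of the registers starts as `⟨1, A, B⟩` and grows by at most one dimension per multiplication or
inversion. Suppose four of these suffice. Then the components `C`, `D` of `(A + ξ B)⁻¹` lie in the
span after the fourth, so a combination `α C + β D` with `(α, β) ≠ 0` lies in the span after the
third. Restrict to inputs that are polynomials in one matrix `M`. There `α C + β D` equals
`(α a - β M) / (a² + τ M²)` for `(A, B) = (a, M)`, and `(α - β s) / ((1 + τ s²) M)` for
`(A, B) = (M, s M)`, whereas in at least one of the two families the registers after two operations
are still polynomials in `M` of low degree: an inverse of a register is available only if that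
register is invertible at every input, which along `(a, M)` leaves constants and multiples of
`a² + τ M²`. One more operation cannot produce the required fraction. Since `k` has at least
three elements and enough quadratic polynomials divide the minimal polynomial of some `M`,
identities of low degree that hold for all `M` are identities between polynomials.

Without additions, a register whose value at the input `(1, 0)` is nonzero has the same value at
`(1, 1)`, and `C` violates this.
-/

namespace Frobenius

variable {k : Type*} [Field k] {τ : k} {n : ℕ}

/-! ### Arithmetic of `A + ξ B` -/

theorem root_mul_root (τ : k) :
    AdjoinRoot.root (X ^ 2 + C τ : k[X]) * AdjoinRoot.root (X ^ 2 + C τ : k[X]) =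
      -AdjoinRoot.of (X ^ 2 + C τ : k[X]) τ := by
  have h : AdjoinRoot.mk (X ^ 2 + C τ : k[X]) (X ^ 2 + C τ) = 0 := AdjoinRoot.mk_self
  rw [map_add, map_pow, AdjoinRoot.mk_X, AdjoinRoot.mk_C] at h
  rw [← sq]
  exact eq_neg_of_add_eq_zero_left h

theorem eq_zero_of_of_add_root_mul_of_eq_zero {a b : k}
    (h : AdjoinRoot.of (X ^ 2 + C τ : k[X]) a +
      AdjoinRoot.root (X ^ 2 + C τ : k[X]) * AdjoinRoot.of (X ^ 2 + C τ : k[X]) b = 0) :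
    a = 0 ∧ b = 0 := by
  have hmk : AdjoinRoot.mk (X ^ 2 + C τ : k[X]) (C b * X + C a) = 0 := by
    simp only [map_add, map_mul, AdjoinRoot.mk_X, AdjoinRoot.mk_C]
    linear_combination h
  have hzero : C b * X + C a = 0 :=
    eq_zero_of_dvd_of_degree_lt (AdjoinRoot.mk_eq_zero.mp hmk)
      (degree_linear_le.trans_lt (by rw [degree_X_pow_add_C two_pos]; norm_num))
  exact ⟨by simpa using congrArg (coeff · 0) hzero,
    by simpa [coeff_C] using congrArg (coeff · 1) hzero⟩

theorem complexify_inj {A B A' B' : Matrix (Fin n) (Fin n) k} :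
    complexify τ A B = complexify τ A' B' ↔ A = A' ∧ B = B' := by
  refine ⟨fun h => ?_, fun h => by rw [h.1, h.2]⟩
  have hentry (i j : Fin n) : A i j - A' i j = 0 ∧ B i j - B' i j = 0 := by
    have hij := congrFun (congrFun h i) j
    simp only [complexify, Matrix.add_apply, Matrix.smul_apply, Matrix.map_apply,
      smul_eq_mul] at hij
    refine eq_zero_of_of_add_root_mul_of_eq_zero (τ := τ) ?_
    rw [map_sub, map_sub]
    linear_combination hij
  exact ⟨Matrix.ext fun i j => sub_eq_zero.mp (hentry i j).1,
    Matrix.ext fun i j => sub_eq_zero.mp (hentry i j).2⟩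

theorem complexify_mul (τ : k) (A B A' B' : Matrix (Fin n) (Fin n) k) :
    complexify τ A B * complexify τ A' B' =
      complexify τ (A * A' - τ • (B * B')) (A * B' + B * A') := by
  simp only [complexify, Matrix.map_sub _ (map_sub _), Matrix.map_add _ (map_add _),
    Matrix.map_smul' _ _ _ (map_mul _), Matrix.map_mul, add_mul, mul_add, smul_mul_assoc,
    mul_smul_comm, smul_smul, root_mul_root, neg_smul, smul_add]
  abel

theorem complexify_one_zero (τ : k) :
    complexify τ (1 : Matrix (Fin n) (Fin n) k) 0 = 1 := by
  rw [complexify, Matrix.map_one _ (map_zero _) (map_one _), Matrix.map_zero _ (map_zero _),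
    smul_zero, add_zero]

theorem complexify_mul_eq_one_iff {A B U V : Matrix (Fin n) (Fin n) k} :
    complexify τ A B * complexify τ U V = 1 ↔
      A * U - τ • (B * V) = 1 ∧ A * V + B * U = 0 := by
  rw [complexify_mul, ← complexify_one_zero, complexify_inj]

theorem Program.invertsAt_complexify_iff {Γ : Program k} {A B U V : Matrix (Fin n) (Fin n) k}
    (h : complexify τ A B * complexify τ U V = 1) :
    Γ.InvertsAt (complexify τ A B) ↔ Γ.Computes A B U V := by
  have hinv : (complexify τ A B)⁻¹ = complexify τ U V := Matrix.inv_eq_right_inv h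
  refine ⟨fun ⟨A', B', U', V', hAB, hUV, hΓ⟩ => ?_, fun hΓ => ⟨A, B, U, V, rfl, hinv, hΓ⟩⟩
  obtain ⟨rfl, rfl⟩ := complexify_inj.mp hAB
  obtain ⟨rfl, rfl⟩ := complexify_inj.mp (hinv.symm.trans hUV)
  exact hΓ

/-! ### Frobenius inversion -/

section Ring

variable {R : Type*} [Ring R] [Algebra k R]

theorem mul_frobenius_eq {x x' : R} (hx : x * x' = 1) (y j : R) : x * (x' * y * j) = y * j := by
  rw [← mul_assoc, ← mul_assoc, hx, one_mul]

theorem frobenius₁_computes {a b a' j : R} (ha : a * a' = 1) (ha' : a' * a = 1)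
    (hj : (a + τ • (b * a' * b)) * j = 1) (hj' : j * (a + τ • (b * a' * b)) = 1) :
    (frobenius₁ τ).Computes a b j (-(a' * b * j)) := by
  rw [mul_assoc b] at hj hj'
  refine ⟨[a, b, a', a' * b, b * (a' * b), (1 : k) • a, τ • (b * (a' * b)),
    (1 : k) • a + τ • (b * (a' * b)), j, a' * b * j, (-1 : k) • (a' * b * j)],
    ⟨_, ⟨a, rfl, ha, ha'⟩, _, ⟨_, _, rfl, rfl, rfl⟩, _, ⟨_, _, rfl, rfl, rfl⟩, _, ⟨_, rfl, rfl⟩,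
      _, ⟨_, rfl, rfl⟩, _, ⟨_, _, rfl, rfl, rfl⟩, j, ⟨_, rfl, ?_, ?_⟩, _, ⟨_, _, rfl, rfl, rfl⟩,
      _, ⟨_, rfl, rfl⟩, rfl⟩, rfl, ?_⟩
  · rwa [one_smul]
  · rwa [one_smul]
  · simp [frobenius₁]

theorem frobenius₂_computes {a b b' j : R} (hb : b * b' = 1) (hb' : b' * b = 1)
    (hj : (τ • b + a * b' * a) * j = 1) (hj' : j * (τ • b + a * b' * a) = 1) :
    (frobenius₂ τ).Computes a b (b' * a * j) (-j) := by
  rw [mul_assoc a] at hj hj'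
  refine ⟨[a, b, b', b' * a, a * (b' * a), τ • b, (1 : k) • (a * (b' * a)),
    τ • b + (1 : k) • (a * (b' * a)), j, b' * a * j, (-1 : k) • j],
    ⟨_, ⟨b, rfl, hb, hb'⟩, _, ⟨_, _, rfl, rfl, rfl⟩, _, ⟨_, _, rfl, rfl, rfl⟩, _, ⟨_, rfl, rfl⟩,
      _, ⟨_, rfl, rfl⟩, _, ⟨_, _, rfl, rfl, rfl⟩, j, ⟨_, rfl, ?_, ?_⟩, _, ⟨_, _, rfl, rfl, rfl⟩,
      _, ⟨_, rfl, rfl⟩, rfl⟩, rfl, ?_⟩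
  · rwa [one_smul]
  · rwa [one_smul]
  · simp [frobenius₂]

end Ring

theorem complexify_mul_frobenius₁ {A B : Matrix (Fin n) (Fin n) k} (hA : IsUnit A)
    (hS : IsUnit (A + τ • (B * A⁻¹ * B))) :
    complexify τ A B * complexify τ (A + τ • (B * A⁻¹ * B))⁻¹
      (-(A⁻¹ * B * (A + τ • (B * A⁻¹ * B))⁻¹)) = 1 := by
  have hA' := Matrix.mul_nonsing_inv A ((Matrix.isUnit_iff_isUnit_det A).mp hA)
  have hS' := Matrix.mul_nonsing_inv _ ((Matrix.isUnit_iff_isUnit_det _).mp hS)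
  rw [complexify_mul_eq_one_iff, mul_neg, smul_neg, sub_neg_eq_add, mul_neg, neg_add_eq_zero]
  refine ⟨?_, mul_frobenius_eq hA' B _⟩
  simpa only [add_mul, smul_mul_assoc, mul_assoc] using hS'

theorem complexify_mul_frobenius₂ {A B : Matrix (Fin n) (Fin n) k} (hB : IsUnit B)
    (hS : IsUnit (τ • B + A * B⁻¹ * A)) :
    complexify τ A B * complexify τ (B⁻¹ * A * (τ • B + A * B⁻¹ * A)⁻¹)
      (-(τ • B + A * B⁻¹ * A)⁻¹) = 1 := by
  have hB' := Matrix.mul_nonsing_inv B ((Matrix.isUnit_iff_isUnit_det B).mp hB)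
  have hS' := Matrix.mul_nonsing_inv _ ((Matrix.isUnit_iff_isUnit_det _).mp hS)
  rw [complexify_mul_eq_one_iff, mul_neg, smul_neg, sub_neg_eq_add, mul_neg, neg_add_eq_zero,
    add_comm]
  refine ⟨?_, (mul_frobenius_eq hB' A _).symm⟩
  simpa only [add_mul, smul_mul_assoc, mul_assoc] using hS'

theorem frobenius₁_invertsOn (τ : k) (n : ℕ) : (frobenius₁ τ).InvertsOn (S₁ τ n) := by
  rintro Z ⟨A, B, rfl, -, hA, hS⟩
  have hAdet := (Matrix.isUnit_iff_isUnit_det _).mp hA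
  have hSdet := (Matrix.isUnit_iff_isUnit_det _).mp hS
  exact (Program.invertsAt_complexify_iff (complexify_mul_frobenius₁ hA hS)).mpr
    (frobenius₁_computes (Matrix.mul_nonsing_inv _ hAdet) (Matrix.nonsing_inv_mul _ hAdet)
      (Matrix.mul_nonsing_inv _ hSdet) (Matrix.nonsing_inv_mul _ hSdet))

theorem frobenius₂_invertsOn (τ : k) (n : ℕ) : (frobenius₂ τ).InvertsOn (S₂ τ n) := by
  rintro Z ⟨A, B, rfl, -, hB, hS⟩
  have hBdet := (Matrix.isUnit_iff_isUnit_det _).mp hB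
  have hSdet := (Matrix.isUnit_iff_isUnit_det _).mp hS
  exact (Program.invertsAt_complexify_iff (complexify_mul_frobenius₂ hB hS)).mpr
    (frobenius₂_computes (Matrix.mul_nonsing_inv _ hBdet) (Matrix.nonsing_inv_mul _ hBdet)
      (Matrix.mul_nonsing_inv _ hSdet) (Matrix.nonsing_inv_mul _ hSdet))

theorem frobeniusInversion_invertsAt {Z : Matrix (Fin n) (Fin n) (QuadExt τ)}
    (hZ : Z ∈ S₁ τ n ∪ S₂ τ n) : (frobeniusInversion τ Z).InvertsAt Z := by
  unfold frobeniusInversion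
  split_ifs with h
  · exact frobenius₁_invertsOn τ n Z h
  · exact frobenius₂_invertsOn τ n Z (hZ.resolve_left h)

theorem frobeniusInversion_cost (τ : k) (Z : Matrix (Fin n) (Fin n) (QuadExt τ)) :
    (frobeniusInversion τ Z).invs = 2 ∧ (frobeniusInversion τ Z).muls = 3 ∧
      (frobeniusInversion τ Z).adds = 1 := by
  unfold frobeniusInversion
  split_ifs <;> exact ⟨rfl, rfl, rfl⟩

/-! ### Running a program on a family of inputs at once -/

section Pi

variable {ι R : Type*}

theorem getElem?_eq_some_of_forall_apply [Nonempty ι] {s : List (ι → R)} {i : ℕ} {y : ι → R}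
    (hy : ∀ z, (s.map (· z))[i]? = some (y z)) : s[i]? = some y := by
  simp only [List.getElem?_map, Option.map_eq_some_iff] at hy
  obtain ⟨f, hf, -⟩ := hy (Classical.arbitrary ι)
  suffices f = y from this ▸ hf
  funext z
  obtain ⟨g, hg, hgz⟩ := hy z
  rwa [Option.some_inj.mp (hf.symm.trans hg)]

variable [Ring R] [Algebra k R]

theorem Instr.yields_of_forall_apply [Nonempty ι] {I : Instr k} {s : List (ι → R)} {x : ι → R}
    (h : ∀ z, I.Yields (s.map (· z)) (x z)) : I.Yields s x := by
  cases I with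
  | const c => exact funext h
  | smul c i =>
    choose y hy hx using h
    exact ⟨y, getElem?_eq_some_of_forall_apply hy, funext hx⟩
  | add i j | mul i j =>
    choose y w hy hw hx using h
    exact ⟨y, w, getElem?_eq_some_of_forall_apply hy, getElem?_eq_some_of_forall_apply hw,
      funext hx⟩
  | inv i =>
    choose y hy hyx hxy using h
    exact ⟨y, getElem?_eq_some_of_forall_apply hy, funext hyx, funext hxy⟩

theorem exists_exec_of_forall_apply [Nonempty ι] {L : List (Instr k)} {s : List (ι → R)}
    {t : ι → List R} (h : ∀ z, Exec L (s.map (· z)) (t z)) :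
    ∃ T : List (ι → R), Exec L s T ∧ ∀ z, T.map (· z) = t z := by
  induction L generalizing s with
  | nil => exact ⟨s, rfl, fun z => (h z).symm⟩
  | cons I L ih =>
    choose x hx hL using h
    obtain ⟨T, hT, hTt⟩ := ih (s := s ++ [x]) fun z => by
      simpa only [List.map_append, List.map_cons, List.map_nil] using hL z
    exact ⟨T, ⟨x, Instr.yields_of_forall_apply hx, hT⟩, hTt⟩

theorem Program.computes_of_forall_apply [Nonempty ι] {Γ : Program k} {a b c d : ι → R}
    (h : ∀ z, Γ.Computes (a z) (b z) (c z) (d z)) : Γ.Computes a b c d := by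
  choose t ht hc hd using h
  obtain ⟨T, hT, hTt⟩ := exists_exec_of_forall_apply (s := [a, b]) ht
  exact ⟨T, hT, getElem?_eq_some_of_forall_apply fun z => by rw [hTt, hc],
    getElem?_eq_some_of_forall_apply fun z => by rw [hTt, hd]⟩

end Pi

/-! ### Inputs -/

/-- The pairs `(A, B)` such that `A` and `A + τ B A⁻¹ B` are invertible, that is, the pairs of
components of the members of `S₁`. -/
def Input (τ : k) (n : ℕ) : Type _ :=
  {z : Matrix (Fin n) (Fin n) k × Matrix (Fin n) (Fin n) k //
    IsUnit z.1 ∧ IsUnit (z.1 + τ • (z.2 * z.1⁻¹ * z.2))}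

/-- The matrix-valued functions of the input. A program that is run on all inputs at once has its
registers in this `k`-algebra. -/
abbrev InputFun (τ : k) (n : ℕ) : Type _ := Input τ n → Matrix (Fin n) (Fin n) k

/-- The component `A` of `A + ξ B`. -/
def re (τ : k) (n : ℕ) : InputFun τ n := fun z => z.1.1

/-- The component `B` of `A + ξ B`. -/
def im (τ : k) (n : ℕ) : InputFun τ n := fun z => z.1.2

/-- The component `C` of `(A + ξ B)⁻¹ = C + ξ D`. -/
noncomputable def invRe (τ : k) (n : ℕ) : InputFun τ n :=
  fun z => (re τ n z + τ • (im τ n z * (re τ n z)⁻¹ * im τ n z))⁻¹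

/-- The component `D` of `(A + ξ B)⁻¹ = C + ξ D`. -/
noncomputable def invIm (τ : k) (n : ℕ) : InputFun τ n :=
  fun z => -((re τ n z)⁻¹ * im τ n z * invRe τ n z)

theorem complexify_mul_complexify_inv (z : Input τ n) :
    complexify τ (re τ n z) (im τ n z) * complexify τ (invRe τ n z) (invIm τ n z) = 1 :=
  complexify_mul_frobenius₁ z.2.1 z.2.2

theorem schur_mul_of_commute {A B : Matrix (Fin n) (Fin n) k} (hA : IsUnit A) (h : Commute A B) :
    (A + τ • (B * A⁻¹ * B)) * A = A ^ 2 + τ • B ^ 2 := by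
  have hA' := Matrix.nonsing_inv_mul A ((Matrix.isUnit_iff_isUnit_det A).mp hA)
  rw [add_mul, smul_mul_assoc, mul_assoc, ← h.eq, mul_assoc B, ← mul_assoc A⁻¹, hA', one_mul,
    sq, sq]

theorem exists_input_of_commute {A B : Matrix (Fin n) (Fin n) k} (hA : IsUnit A)
    (h : Commute A B) (hAB : IsUnit (A ^ 2 + τ • B ^ 2)) :
    ∃ z : Input τ n, re τ n z = A ∧ im τ n z = B := by
  rw [← schur_mul_of_commute hA h, ← hA.unit_spec, Units.isUnit_mul_units, hA.unit_spec] at hAB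
  exact ⟨⟨(A, B), hA, hAB⟩, rfl, rfl⟩

theorem exists_input_scalar {a b : k} (ha : a ≠ 0) (hab : a ^ 2 + τ * b ^ 2 ≠ 0) :
    ∃ z : Input τ n, re τ n z = a • 1 ∧ im τ n z = b • 1 := by
  have isUnit_smul_one {c : k} (hc : c ≠ 0) : IsUnit (c • (1 : Matrix (Fin n) (Fin n) k)) :=
    isUnit_one.smul (Units.mk0 c hc)
  refine exists_input_of_commute (isUnit_smul_one ha)
    ((Commute.one_left _).smul_left a) ?_
  rw [_root_.smul_pow, _root_.smul_pow, one_pow, smul_smul, ← add_smul]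
  exact isUnit_smul_one hab

instance : Nonempty (Input τ n) :=
  let ⟨z, _⟩ := exists_input_scalar (a := 1) (b := 0) one_ne_zero (by simp)
  ⟨z⟩

theorem invRe_mul_norm_of_commute {z : Input τ n} (h : Commute (re τ n z) (im τ n z)) :
    invRe τ n z * (re τ n z ^ 2 + τ • im τ n z ^ 2) = re τ n z := by
  obtain ⟨h₁, h₂⟩ := complexify_mul_eq_one_iff.mp
    (mul_eq_one_comm.mp (complexify_mul_complexify_inv z))
  calc invRe τ n z * (re τ n z ^ 2 + τ • im τ n z ^ 2)
      = (invRe τ n z * re τ n z - τ • (invIm τ n z * im τ n z)) * re τ n z +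
          τ • ((invRe τ n z * im τ n z + invIm τ n z * re τ n z) * im τ n z) +
          τ • (invIm τ n z * (im τ n z * re τ n z - re τ n z * im τ n z)) := by
        simp only [mul_add, add_mul, sub_mul, mul_sub, smul_add, smul_sub, mul_smul_comm,
          smul_mul_assoc, sq, mul_assoc]
        abel
    _ = re τ n z := by
        rw [h₁, h₂, h.eq, one_mul, zero_mul, sub_self, mul_zero, smul_zero, add_zero, add_zero]

theorem invIm_mul_norm_of_commute {z : Input τ n} (h : Commute (re τ n z) (im τ n z)) :
    invIm τ n z * (re τ n z ^ 2 + τ • im τ n z ^ 2) = -im τ n z := by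
  obtain ⟨h₁, h₂⟩ := complexify_mul_eq_one_iff.mp
    (mul_eq_one_comm.mp (complexify_mul_complexify_inv z))
  calc invIm τ n z * (re τ n z ^ 2 + τ • im τ n z ^ 2)
      = (invRe τ n z * im τ n z + invIm τ n z * re τ n z) * re τ n z -
          (invRe τ n z * re τ n z - τ • (invIm τ n z * im τ n z)) * im τ n z +
          invRe τ n z * (re τ n z * im τ n z - im τ n z * re τ n z) := by
        simp only [mul_add, add_mul, sub_mul, mul_sub, mul_smul_comm, smul_mul_assoc, sq,
          mul_assoc]
        abel
    _ = -im τ n z := by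
        rw [h₁, h₂, h.eq, one_mul, zero_mul, sub_self, mul_zero, zero_sub, add_zero]

theorem Program.InvertsOn.computes_of_S₁ {Γ : Program k} (h : Γ.InvertsOn (S₁ τ n)) :
    Γ.Computes (re τ n) (im τ n) (invRe τ n) (invIm τ n) := by
  refine Program.computes_of_forall_apply fun z => ?_
  have hinv := complexify_mul_complexify_inv z
  exact (Program.invertsAt_complexify_iff hinv).mp
    (h _ ⟨_, _, rfl, IsUnit.of_mul_eq_one _ hinv, z.2.1, z.2.2⟩)

/- Multiplication by `ξ` maps `A + ξ B` to `-τ B + ξ A` and `S₁` to `S₂`. -/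
theorem Program.InvertsOn.computes_of_S₂ {Γ : Program k} (hτ : τ ≠ 0)
    (h : Γ.InvertsOn (S₂ τ n)) :
    Γ.Computes (-τ • im τ n) (re τ n) (invIm τ n) (-τ⁻¹ • invRe τ n) := by
  refine Program.computes_of_forall_apply fun z => ?_
  have hinv : complexify τ (-τ • im τ n z) (re τ n z) *
      complexify τ (invIm τ n z) (-τ⁻¹ • invRe τ n z) = 1 := by
    obtain ⟨h₁, h₂⟩ := complexify_mul_eq_one_iff.mp (complexify_mul_complexify_inv z)
    refine complexify_mul_eq_one_iff.mpr ⟨?_, ?_⟩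
    · rw [← h₁, mul_smul_comm, smul_smul, smul_mul_assoc, mul_neg, mul_inv_cancel₀ hτ]
      module
    · rw [← h₂, smul_mul_smul_comm, neg_mul_neg, mul_inv_cancel₀ hτ, one_smul, add_comm]
  have hS : τ • re τ n z + -τ • im τ n z * (re τ n z)⁻¹ * -τ • im τ n z =
      τ • (re τ n z + τ • (im τ n z * (re τ n z)⁻¹ * im τ n z)) := by
    simp only [smul_mul_assoc, mul_smul_comm, smul_smul, smul_add, neg_mul_neg]
  exact (Program.invertsAt_complexify_iff hinv).mp
    (h _ ⟨_, _, rfl, IsUnit.of_mul_eq_one _ hinv, z.2.1,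
      hS ▸ z.2.2.smul (Units.mk0 τ hτ)⟩)

/-! ### Consequences of irreducibility -/

theorem eq_zero_of_sq_add_mul_sq_eq_zero (hτ : Irreducible (X ^ 2 + C τ : k[X])) {x y : k}
    (h : x ^ 2 + τ * y ^ 2 = 0) : x = 0 ∧ y = 0 := by
  by_cases hy : y = 0
  · subst hy
    exact ⟨by simpa using h, rfl⟩
  · refine absurd ?_ (hτ.not_isRoot_of_natDegree_ne_one (x := x / y) ?_)
    · simp only [IsRoot, eval_add, eval_pow, eval_X, eval_C]
      field_simp
      linear_combination h
    · rw [natDegree_X_pow_add_C]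
      norm_num

theorem tau_ne_zero (hτ : Irreducible (X ^ 2 + C τ : k[X])) : τ ≠ 0 := by
  rintro rfl
  exact one_ne_zero (eq_zero_of_sq_add_mul_sq_eq_zero hτ (x := 0) (y := 1) (by simp)).2

theorem one_add_mul_sq_ne_zero (hτ : Irreducible (X ^ 2 + C τ : k[X])) (s : k) :
    1 + τ * s ^ 2 ≠ 0 := fun h =>
  one_ne_zero (eq_zero_of_sq_add_mul_sq_eq_zero hτ (x := 1) (y := s) (by rwa [one_pow])).1

theorem exists_ne_zero_ne_one (hτ : Irreducible (X ^ 2 + C τ : k[X])) : ∃ t : k, t ≠ 0 ∧ t ≠ 1 :=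
  ⟨-τ, neg_ne_zero.mpr (tau_ne_zero hτ), fun h =>
    one_add_mul_sq_ne_zero hτ 1 (by linear_combination -h)⟩

/-! ### The lower bound for additions -/

section WithoutAdd

variable {ι R : Type*} [Ring R] [Nontrivial R] [Algebra k R] {z₀ z₁ : ι}

theorem Instr.Yields.apply_eq_zero_or_eq {I : Instr k} {s : List (ι → R)} {x : ι → R}
    (hI : I.Yields s x) (hadd : I.isAdd = false) (hs : ∀ y ∈ s, y z₀ = 0 ∨ y z₀ = y z₁) :
    x z₀ = 0 ∨ x z₀ = x z₁ := by
  have hreg {i : ℕ} {y : ι → R} (hy : s[i]? = some y) : y z₀ = 0 ∨ y z₀ = y z₁ :=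
    hs y (List.mem_of_getElem? hy)
  cases I with
  | const c => exact Or.inr (by rw [show x = algebraMap k (ι → R) c from hI]; rfl)
  | smul c i =>
    obtain ⟨y, hy, rfl⟩ := hI
    exact (hreg hy).imp (by simp +contextual) (by simp +contextual)
  | add i j => simp [Instr.isAdd] at hadd
  | mul i j =>
    obtain ⟨y, w, hy, hw, rfl⟩ := hI
    rcases hreg hy with hy₀ | hy₀
    · exact Or.inl (by simp [hy₀])
    · exact (hreg hw).imp (by simp +contextual) (by simp +contextual [hy₀])
  | inv i =>
    obtain ⟨y, hy, hyx, hxy⟩ := hI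
    have hxy₀ : x z₀ * y z₀ = 1 := congrFun hxy z₀
    have hyx₁ : y z₁ * x z₁ = 1 := congrFun hyx z₁
    rcases hreg hy with hy₀ | hy₀
    · exact absurd hxy₀ (by simp [hy₀])
    · exact Or.inr (left_inv_eq_right_inv (hy₀ ▸ hxy₀) hyx₁)

theorem Exec.apply_eq_zero_or_eq {L : List (Instr k)} {s t : List (ι → R)} (hL : Exec L s t)
    (hadd : L.countP Instr.isAdd = 0) (hs : ∀ x ∈ s, x z₀ = 0 ∨ x z₀ = x z₁) :
    ∀ x ∈ t, x z₀ = 0 ∨ x z₀ = x z₁ := by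
  induction L generalizing s with
  | nil =>
    obtain rfl : t = s := hL
    exact hs
  | cons I L ih =>
    obtain ⟨x, hI, hL⟩ := hL
    simp only [List.countP_eq_zero, List.forall_mem_cons, Bool.not_eq_true] at hadd
    refine ih hL (by simpa only [List.countP_eq_zero, Bool.not_eq_true] using hadd.2) ?_
    rw [List.forall_mem_append, List.forall_mem_singleton]
    exact ⟨hs, hI.apply_eq_zero_or_eq hadd.1 hs⟩

theorem Program.Computes.apply_eq_zero_or_eq {Γ : Program k} {a b c d : ι → R}
    (h : Γ.Computes a b c d) (hadd : Γ.adds = 0) (ha : a z₀ = 0 ∨ a z₀ = a z₁)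
    (hb : b z₀ = 0 ∨ b z₀ = b z₁) :
    (c z₀ = 0 ∨ c z₀ = c z₁) ∧ (d z₀ = 0 ∨ d z₀ = d z₁) := by
  obtain ⟨t, ht, hc, hd⟩ := h
  have hreg := ht.apply_eq_zero_or_eq hadd (by simpa using ⟨ha, hb⟩)
  exact ⟨hreg c (List.mem_of_getElem? hc), hreg d (List.mem_of_getElem? hd)⟩

end WithoutAdd

theorem smul_invRe_of_scalar {z : Input τ n} {a b : k} (ha : re τ n z = a • 1)
    (hb : im τ n z = b • 1) : (a ^ 2 + τ * b ^ 2) • invRe τ n z = a • 1 := by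
  have h := invRe_mul_norm_of_commute (z := z)
    (by rw [ha]; exact (Commute.one_left _).smul_left a)
  rw [ha, hb, _root_.smul_pow, _root_.smul_pow, one_pow, smul_smul, ← add_smul, mul_smul_comm,
    mul_one] at h
  exact h

theorem one_le_adds (hτ : Irreducible (X ^ 2 + C τ : k[X])) (hn : n ≠ 0) {Γ : Program k}
    (h : Γ.InvertsOn (S₁ τ n) ∨ Γ.InvertsOn (S₂ τ n)) : 1 ≤ Γ.adds := by
  have hτ₀ := tau_ne_zero hτ
  have : NeZero n := ⟨hn⟩
  by_contra hlt
  have hadd : Γ.adds = 0 := by omega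
  obtain ⟨z₀, hre₀, him₀⟩ := exists_input_scalar (τ := τ) (n := n) (a := 1) (b := 0)
    one_ne_zero (by simp)
  obtain ⟨z₁, hre₁, him₁⟩ := exists_input_scalar (τ := τ) (n := n) (a := 1) (b := 1)
    one_ne_zero (by simpa using one_add_mul_sq_ne_zero hτ 1)
  have hre : re τ n z₀ = 0 ∨ re τ n z₀ = re τ n z₁ := Or.inr (hre₀.trans hre₁.symm)
  have him : im τ n z₀ = 0 := by rw [him₀, zero_smul]
  have hinv₀ : invRe τ n z₀ = 1 := by simpa using smul_invRe_of_scalar hre₀ him₀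
  have hinv₁ : (1 + τ) • invRe τ n z₁ = 1 := by simpa using smul_invRe_of_scalar hre₁ him₁
  have hinv : invRe τ n z₀ = 0 ∨ invRe τ n z₀ = invRe τ n z₁ := by
    rcases h with h | h
    · exact (h.computes_of_S₁.apply_eq_zero_or_eq hadd hre (Or.inl him)).1
    · simpa [hτ₀] using
        ((h.computes_of_S₂ hτ₀).apply_eq_zero_or_eq hadd (Or.inl (by simp [him])) hre).2
  rw [← hinv.resolve_left (hinv₀ ▸ one_ne_zero), hinv₀, add_smul, one_smul, add_eq_left] at hinv₁
  exact smul_ne_zero hτ₀ one_ne_zero hinv₁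

/-! ### Spans of registers -/

section Chain

variable {R : Type*} [Ring R] [Algebra k R] {V W V' : Submodule k R} {M N : ℕ}

/-- `W` arises from `V` by adjoining one product of members of `V`, or the inverse of one: the
effect of a counted instruction on the span of the registers. -/
def Step (V W : Submodule k R) : Prop :=
  ∃ r : R, W = V ⊔ k ∙ r ∧
    ((∃ u ∈ V, ∃ v ∈ V, r = u * v) ∨ ∃ u ∈ V, u * r = 1 ∧ r * u = 1)

/-- `W` arises from `V` by `N` consecutive steps. -/
def Chain : ℕ → Submodule k R → Submodule k R → Prop
  | 0, V, W => V = W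
  | N + 1, V, W => ∃ V', Step V V' ∧ Chain N V' W

theorem Chain.trans (h : Chain M V V') (h' : Chain N V' W) : Chain (M + N) V W := by
  induction M generalizing V with
  | zero =>
    obtain rfl : V = V' := h
    rwa [Nat.zero_add]
  | succ M ih =>
    obtain ⟨V₁, hstep, h⟩ := h
    rw [Nat.succ_add]
    exact ⟨V₁, hstep, ih h⟩

theorem Chain.le (h : Chain N V W) : V ≤ W := by
  induction N generalizing V with
  | zero => exact le_of_eq h
  | succ N ih =>
    obtain ⟨V₁, ⟨r, rfl, -⟩, h⟩ := h
    exact le_sup_left.trans (ih h)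

theorem Chain.mono (hone : (1 : R) ∈ V) (h : Chain M V W) (hMN : M ≤ N) : Chain N V W := by
  have hstep : Step V V :=
    ⟨1, by simpa [eq_comm] using hone, Or.inl ⟨1, hone, 1, hone, (mul_one 1).symm⟩⟩
  induction hMN with
  | refl => exact h
  | step _ ih => exact ⟨V, hstep, ih⟩

theorem Instr.Yields.exists_chain {I : Instr k} {s : List R} {x : R} (hI : I.Yields s x)
    (hone : (1 : R) ∈ V) (hs : ∀ y ∈ s, y ∈ V) :
    ∃ W, Chain ([I].countP Instr.isMul + [I].countP Instr.isInv) V W ∧ x ∈ W := by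
  have hreg {i : ℕ} {y : R} (hy : s[i]? = some y) : y ∈ V := hs y (List.mem_of_getElem? hy)
  have hx : x ∈ V ⊔ k ∙ x := Submodule.mem_sup_right (Submodule.mem_span_singleton_self x)
  cases I with
  | const c =>
    obtain rfl : x = algebraMap k R c := hI
    exact ⟨V, rfl, by simpa only [Algebra.algebraMap_eq_smul_one] using V.smul_mem c hone⟩
  | smul c i =>
    obtain ⟨y, hy, rfl⟩ := hI
    exact ⟨V, rfl, V.smul_mem c (hreg hy)⟩
  | add i j =>
    obtain ⟨y, w, hy, hw, rfl⟩ := hI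
    exact ⟨V, rfl, V.add_mem (hreg hy) (hreg hw)⟩
  | mul i j =>
    obtain ⟨y, w, hy, hw, hyw⟩ := hI
    exact ⟨_, ⟨_, ⟨x, rfl, Or.inl ⟨y, hreg hy, w, hreg hw, hyw⟩⟩, rfl⟩, hx⟩
  | inv i =>
    obtain ⟨y, hy, hyx⟩ := hI
    exact ⟨_, ⟨_, ⟨x, rfl, Or.inr ⟨y, hreg hy, hyx⟩⟩, rfl⟩, hx⟩

theorem Exec.exists_chain {L : List (Instr k)} {s t : List R} (hL : Exec L s t)
    (hone : (1 : R) ∈ V) (hs : ∀ x ∈ s, x ∈ V) :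
    ∃ W, Chain (L.countP Instr.isMul + L.countP Instr.isInv) V W ∧ ∀ x ∈ t, x ∈ W := by
  induction L generalizing s V with
  | nil =>
    obtain rfl : t = s := hL
    exact ⟨V, rfl, hs⟩
  | cons I L ih =>
    obtain ⟨x, hI, hL⟩ := hL
    obtain ⟨V₁, hV₁, hx⟩ := hI.exists_chain hone hs
    obtain ⟨W, hW, ht⟩ := ih hL (hV₁.le hone) <| by
      rw [List.forall_mem_append, List.forall_mem_singleton]
      exact ⟨fun y hy => hV₁.le (hs y hy), hx⟩
    refine ⟨W, ?_, ht⟩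
    have h := hV₁.trans hW
    rwa [add_add_add_comm, ← List.countP_append, ← List.countP_append] at h

theorem mem_sup_span_singleton {r f : R} :
    f ∈ V ⊔ k ∙ r ↔ ∃ v ∈ V, ∃ γ : k, f = v + γ • r := by
  simp only [Submodule.mem_sup, Submodule.mem_span_singleton, exists_exists_eq_and,
    eq_comm (a := f)]

theorem exists_smul_add_smul_mem {r c d : R} (hc : c ∈ V ⊔ k ∙ r) (hd : d ∈ V ⊔ k ∙ r) :
    ∃ α β : k, (α ≠ 0 ∨ β ≠ 0) ∧ α • c + β • d ∈ V := by
  obtain ⟨v, hv, γ, rfl⟩ := mem_sup_span_singleton.mp hc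
  obtain ⟨w, hw, δ, rfl⟩ := mem_sup_span_singleton.mp hd
  by_cases hγ : γ = 0
  · exact ⟨1, 0, Or.inl one_ne_zero, by simpa [hγ] using hv⟩
  · refine ⟨δ, -γ, Or.inr (neg_ne_zero.mpr hγ), ?_⟩
    have h : δ • (v + γ • r) + -γ • (w + δ • r) = δ • v + -γ • w := by module
    rw [h]
    exact V.add_mem (V.smul_mem _ hv) (V.smul_mem _ hw)

end Chain

/-! ### Polynomials with many quadratic divisors -/

/-- The norm `p² + τ q²` of `p + ξ q`. -/
noncomputable def normPoly (τ : k) (p q : k[X]) : k[X] := p ^ 2 + C τ * q ^ 2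

theorem eval_normPoly (τ : k) (p q : k[X]) (x : k) :
    (normPoly τ p q).eval x = p.eval x ^ 2 + τ * q.eval x ^ 2 := by
  simp only [normPoly, eval_add, eval_mul, eval_pow, eval_C]

theorem irreducible_normPoly (hτ : Irreducible (X ^ 2 + C τ : k[X])) {p q : k[X]}
    (hdeg : (normPoly τ p q).natDegree = 2) (hpq : ∀ x, p.eval x = 0 → q.eval x ≠ 0) :
    Irreducible (normPoly τ p q) := by
  refine irreducible_of_degree_le_three_of_not_isRoot (by simp [hdeg]) fun x hx => ?_
  rw [IsRoot, eval_normPoly] at hx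
  obtain ⟨hp, hq⟩ := eq_zero_of_sq_add_mul_sq_eq_zero hτ hx
  exact hpq x hp hq

theorem monic_normPoly_X_sub_C_one (τ a : k) : (normPoly τ (X - C a) 1).Monic := by
  rw [normPoly, one_pow, mul_one]
  refine ((monic_X_sub_C a).pow 2).add_of_left ?_
  rw [degree_pow, degree_X_sub_C]
  exact degree_C_le.trans_lt (by norm_num)

theorem natDegree_normPoly_X_sub_C_one (τ a : k) : (normPoly τ (X - C a) 1).natDegree = 2 := by
  rw [normPoly, one_pow, mul_one, natDegree_add_C, natDegree_pow, natDegree_X_sub_C]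

theorem isCoprime_X_sub_C_of_eval_ne_zero {p : k[X]} {c : k} (h : p.eval c ≠ 0) :
    IsCoprime p (X - C c) :=
  ((irreducible_X_sub_C c).coprime_iff_not_dvd.mpr (by rwa [dvd_iff_isRoot])).symm

theorem isCoprime_normPoly_X_sub_C_one (hτ : Irreducible (X ^ 2 + C τ : k[X])) {a b : k}
    (hab : a ≠ b) : IsCoprime (normPoly τ (X - C a) 1) (normPoly τ (X - C b) 1) := by
  have hirr : Irreducible (normPoly τ (X - C a) 1) :=
    irreducible_normPoly hτ (natDegree_normPoly_X_sub_C_one τ a) (by simp)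
  refine (hirr.isCoprime_or_dvd _).resolve_right fun hdvd => hab ?_
  have heq := eq_of_monic_of_dvd_of_natDegree_le (monic_normPoly_X_sub_C_one τ a)
    (monic_normPoly_X_sub_C_one τ b) hdvd
    (by rw [natDegree_normPoly_X_sub_C_one, natDegree_normPoly_X_sub_C_one])
  simpa [eval_normPoly, sub_eq_zero] using congrArg (eval a) heq

theorem eq_zero_of_forall_quadratic_dvd [DecidableEq k] (hτ : Irreducible (X ^ 2 + C τ : k[X]))
    {h : k[X]} (hdvd : ∀ m : k[X], m.Monic → m.natDegree = 2 → m.eval 0 ≠ 0 → m ∣ h)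
    (S : Finset k) (hdeg : h.natDegree < 2 * S.card + 2 * (S.erase 0).card) : h = 0 := by
  let P := ∏ a ∈ S, normPoly τ (X - C a) 1
  let P' := ∏ a ∈ S.erase 0, (X - C a) ^ 2
  have hP : P.Monic := monic_prod_of_monic _ _ fun a _ => monic_normPoly_X_sub_C_one τ a
  have hP' : P'.Monic := monic_prod_of_monic _ _ fun a _ => (monic_X_sub_C a).pow 2
  have hPdvd : P ∣ h := by
    refine Finset.prod_dvd_of_coprime (fun a _ b _ => isCoprime_normPoly_X_sub_C_one hτ)
      fun a _ => hdvd _ (monic_normPoly_X_sub_C_one τ a) (natDegree_normPoly_X_sub_C_one τ a) ?_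
    rw [eval_normPoly]
    exact fun h0 => by simpa using (eq_zero_of_sq_add_mul_sq_eq_zero hτ h0).2
  have hPdvd' : P' ∣ h := by
    refine Finset.prod_dvd_of_coprime
      (fun a _ b _ hab => (pairwise_coprime_X_sub_C Function.injective_id hab).pow)
      fun a ha => hdvd _ ((monic_X_sub_C a).pow 2) ?_ ?_
    · rw [natDegree_pow, natDegree_X_sub_C]
    · simpa using Finset.ne_of_mem_erase ha
  have hco : IsCoprime P P' :=
    .prod_left fun a _ => .prod_right fun b _ => (isCoprime_X_sub_C_of_eval_ne_zero fun h0 => by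
      rw [eval_normPoly] at h0
      simpa using (eq_zero_of_sq_add_mul_sq_eq_zero hτ h0).2).pow_right
  have hdegP : (P * P').natDegree = 2 * S.card + 2 * (S.erase 0).card := by
    rw [hP.natDegree_mul hP', natDegree_prod_of_monic _ _ fun a _ => monic_normPoly_X_sub_C_one τ a,
      natDegree_prod_of_monic _ _ fun a _ => (monic_X_sub_C a).pow 2]
    simp [natDegree_normPoly_X_sub_C_one, mul_comm]
  exact eq_zero_of_dvd_of_natDegree_lt (hco.mul_dvd hPdvd hPdvd') (hdegP ▸ hdeg)

theorem eq_zero_of_natDegree_le_nine (hτ : Irreducible (X ^ 2 + C τ : k[X])) {h : k[X]}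
    (hdeg : h.natDegree ≤ 9)
    (hdvd : ∀ m : k[X], m.Monic → m.natDegree = 2 → m.eval 0 ≠ 0 → m ∣ h) : h = 0 := by
  classical
  obtain ⟨t, ht0, ht1⟩ := exists_ne_zero_ne_one hτ
  refine eq_zero_of_forall_quadratic_dvd hτ hdvd {0, 1, t} (hdeg.trans_lt ?_)
  simp [Finset.card_insert_of_notMem, ht0.symm, ht1.symm]

/-! ### Matrices with a prescribed annihilator -/

theorem exists_matrix_aeval_eq_zero_iff {g : k[X]} (hg : g.Monic) (hn : g.natDegree = n) :
    ∃ M : Matrix (Fin n) (Fin n) k, ∀ f : k[X], aeval M f = 0 ↔ g ∣ f := by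
  subst hn
  let φ := Algebra.leftMulMatrix
    ((AdjoinRoot.powerBasis' hg).basis.reindex (finCongr (AdjoinRoot.powerBasis'_dim hg)))
  refine ⟨φ (AdjoinRoot.root g), fun f => ?_⟩
  rw [aeval_algHom_apply, map_eq_zero_iff φ (Algebra.leftMulMatrix_injective _),
    AdjoinRoot.aeval_eq, AdjoinRoot.mk_eq_zero]

theorem isUnit_aeval_iff_isCoprime {R : Type*} [Ring R] [Algebra k R] {x : R} {g : k[X]}
    (hg : g ≠ 0) (hx : ∀ f : k[X], aeval x f = 0 ↔ g ∣ f) {p : k[X]} :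
    IsUnit (aeval x p) ↔ IsCoprime p g := by
  refine ⟨fun hu => isCoprime_of_irreducible_dvd (fun h => hg h.2) ?_, fun ⟨u, v, huv⟩ => ?_⟩
  · rintro d hd ⟨p', rfl⟩ ⟨g', rfl⟩
    have hg' : aeval x g' = 0 := by
      rw [← hu.mul_right_eq_zero, ← map_mul, hx]
      exact ⟨p', by ring⟩
    have hdvd : d * g' ∣ 1 * g' := by simpa only [one_mul] using (hx g').mp hg'
    exact hd.not_isUnit
      (isUnit_of_dvd_one ((mul_dvd_mul_iff_right (right_ne_zero_of_mul hg)).mp hdvd))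
  · have huv' : aeval x u * aeval x p = 1 := by
      rw [← map_mul, ← sub_eq_zero, ← map_one (aeval (R := k) x), ← map_sub, hx]
      exact ⟨-v, by linear_combination huv⟩
    exact isUnit_iff_exists.mpr ⟨_, by rwa [← map_mul, mul_comm, map_mul], huv'⟩

/-! ### Functions of the input along polynomial families of commuting pairs -/

/-- On all inputs of the form `(pA(M), pB(M))`, with `M` a matrix, the function `f` takes the
value `p(M)`. -/
def IsPolyAlong (pA pB : k[X]) (f : InputFun τ n) (p : k[X]) : Prop :=
  ∀ (z : Input τ n) (M : Matrix (Fin n) (Fin n) k),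
    re τ n z = aeval M pA → im τ n z = aeval M pB → f z = aeval M p

theorem exists_input_aeval (hn : 2 ≤ n) {pA pB m : k[X]} (hm : m.Monic) (hm2 : m.natDegree = 2)
    (hco : IsCoprime (pA * normPoly τ pA pB) m) {c : k}
    (hc : (pA * normPoly τ pA pB).eval c ≠ 0) :
    ∃ (z : Input τ n) (M : Matrix (Fin n) (Fin n) k), re τ n z = aeval M pA ∧
      im τ n z = aeval M pB ∧ ∀ f : k[X], aeval M f = 0 ↔ m * (X - C c) ^ (n - 2) ∣ f := by
  have hg : ((X - C c) ^ (n - 2) : k[X]).Monic := (monic_X_sub_C c).pow _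
  obtain ⟨M, hM⟩ := exists_matrix_aeval_eq_zero_iff (n := n) (hm.mul hg) (by
    rw [hm.natDegree_mul hg, hm2, (monic_X_sub_C c).natDegree_pow, natDegree_X_sub_C]
    omega)
  have hunit : IsCoprime (pA * normPoly τ pA pB) (m * (X - C c) ^ (n - 2)) :=
    hco.mul_right (isCoprime_X_sub_C_of_eval_ne_zero hc).pow_right
  have hA := (isUnit_aeval_iff_isCoprime (hm.mul hg).ne_zero hM).mpr hunit.of_mul_left_left
  have hQ := (isUnit_aeval_iff_isCoprime (hm.mul hg).ne_zero hM).mpr hunit.of_mul_left_right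
  obtain ⟨z, hre, him⟩ := exists_input_of_commute (τ := τ) (B := aeval M pB) hA
    (by rw [Commute, SemiconjBy, ← map_mul, mul_comm, map_mul])
    (by simpa [normPoly, Algebra.smul_def] using hQ)
  exact ⟨z, M, hre, him, hM⟩

namespace IsPolyAlong

variable {pA pB p q : k[X]} {f g u r : InputFun τ n}

theorem one : IsPolyAlong pA pB (1 : InputFun τ n) 1 := fun z M _ _ => by simp

theorem re : IsPolyAlong pA pB (re τ n) pA := fun _ _ h _ => h

theorem im : IsPolyAlong pA pB (im τ n) pB := fun _ _ _ h => h

theorem add (hf : IsPolyAlong pA pB f p) (hg : IsPolyAlong pA pB g q) :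
    IsPolyAlong pA pB (f + g) (p + q) := fun z M hA hB => by
  rw [Pi.add_apply, hf z M hA hB, hg z M hA hB, map_add]

theorem mul (hf : IsPolyAlong pA pB f p) (hg : IsPolyAlong pA pB g q) :
    IsPolyAlong pA pB (f * g) (p * q) := fun z M hA hB => by
  rw [Pi.mul_apply, hf z M hA hB, hg z M hA hB, map_mul]

theorem smul (c : k) (hf : IsPolyAlong pA pB f p) :
    IsPolyAlong pA pB (c • f) (C c * p) := fun z M hA hB => by
  rw [Pi.smul_apply, hf z M hA hB, map_mul, aeval_C, Algebra.smul_def]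

theorem inv_of_const {c : k} (hc : c ≠ 0) (hu : IsPolyAlong pA pB u (C c)) (hur : u * r = 1) :
    IsPolyAlong pA pB r (C c⁻¹) := fun z M hA hB => by
  have h : u z * r z = 1 := congrFun hur z
  rw [hu z M hA hB, aeval_C, ← Algebra.smul_def] at h
  rw [aeval_C, Algebra.algebraMap_eq_smul_one, ← h, smul_smul, inv_mul_cancel₀ hc, one_smul]

theorem dvd_of_zero (hn : 2 ≤ n) (h : IsPolyAlong pA pB (0 : InputFun τ n) p) {m : k[X]}
    (hm : m.Monic) (hm2 : m.natDegree = 2) (hco : IsCoprime (pA * normPoly τ pA pB) m) {c : k}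
    (hc : (pA * normPoly τ pA pB).eval c ≠ 0) : m ∣ p := by
  obtain ⟨z, M, hA, hB, hM⟩ := exists_input_aeval hn hm hm2 hco hc
  exact (dvd_mul_right _ _).trans ((hM p).mp (h z M hA hB).symm)

theorem isCoprime_of_mul_eq_one (hn : 2 ≤ n) (hu : IsPolyAlong pA pB u p) (hur : u * r = 1)
    {m : k[X]} (hm : m.Monic) (hm2 : m.natDegree = 2)
    (hco : IsCoprime (pA * normPoly τ pA pB) m) {c : k}
    (hc : (pA * normPoly τ pA pB).eval c ≠ 0) : IsCoprime p m := by
  obtain ⟨z, M, hA, hB, hM⟩ := exists_input_aeval hn hm hm2 hco hc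
  have hunit : IsUnit (aeval M p) := hu z M hA hB ▸ IsUnit.of_mul_eq_one _ (congrFun hur z)
  exact ((isUnit_aeval_iff_isCoprime
    (hm.mul ((monic_X_sub_C c).pow _)).ne_zero hM).mp hunit).of_mul_right_left

theorem dvd_of_mul_eq_one (hn : 2 ≤ n) (hu : IsPolyAlong pA pB u p) (hur : u * r = 1)
    (hq : q.Monic) (hqirr : Irreducible q) (hq2 : q.natDegree ≤ 2) (hqp : q ∣ p) {c : k}
    (hc : (pA * normPoly τ pA pB).eval c ≠ 0) : q ∣ pA * normPoly τ pA pB := by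
  by_contra hndvd
  have hco := ((hqirr.isCoprime_or_dvd _).resolve_right hndvd).symm
  obtain ⟨m, hm, hm2, hqm, hmco⟩ : ∃ m : k[X], m.Monic ∧ m.natDegree = 2 ∧ q ∣ m ∧
      IsCoprime (pA * normPoly τ pA pB) m := by
    have hq1 := hqirr.natDegree_pos
    rcases (show q.natDegree = 1 ∨ q.natDegree = 2 by omega) with h | h
    · exact ⟨q ^ 2, hq.pow 2, by rw [hq.natDegree_pow, h], dvd_pow_self q two_ne_zero,
        hco.pow_right⟩
    · exact ⟨q, hq, h, dvd_rfl, hco⟩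
  exact hqirr.not_isUnit
    ((hu.isCoprime_of_mul_eq_one hn hur hm hm2 hmco hc).isUnit_of_dvd' hqp hqm)

end IsPolyAlong

/-- The linear combination `α C + β D` of the components of `(A + ξ B)⁻¹ = C + ξ D`. -/
noncomputable def invComb (τ : k) (n : ℕ) (α β : k) : InputFun τ n :=
  α • invRe τ n + β • invIm τ n

theorem invComb_mul_aeval_normPoly {z : Input τ n} {M : Matrix (Fin n) (Fin n) k} {pA pB : k[X]}
    (hA : re τ n z = aeval M pA) (hB : im τ n z = aeval M pB) (α β : k) :
    invComb τ n α β z * aeval M (normPoly τ pA pB) = aeval M (C α * pA - C β * pB) := by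
  have hcomm : Commute (re τ n z) (im τ n z) := by
    rw [hA, hB, Commute, SemiconjBy, ← map_mul, mul_comm, map_mul]
  have hnorm : aeval M (normPoly τ pA pB) = re τ n z ^ 2 + τ • im τ n z ^ 2 := by
    rw [hA, hB, normPoly, map_add, map_mul, map_pow, map_pow, aeval_C, Algebra.smul_def]
  rw [hnorm, invComb, Pi.add_apply, Pi.smul_apply, Pi.smul_apply, add_mul, smul_mul_assoc,
    smul_mul_assoc, invRe_mul_norm_of_commute hcomm, invIm_mul_norm_of_commute hcomm, hA, hB]
  simp only [map_sub, map_mul, aeval_C, Algebra.smul_def, mul_neg, ← sub_eq_add_neg]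

namespace IsPolyAlong

variable {pA pB p pu pv : k[X]} {u v r : InputFun τ n} {α β γ : k}

theorem zero_of_invComb_mul (hu : IsPolyAlong pA pB u pu)
    (h : IsPolyAlong pA pB (invComb τ n α β * u) p) :
    IsPolyAlong pA pB (0 : InputFun τ n)
      (p * normPoly τ pA pB - (C α * pA - C β * pB) * pu) := fun z M hA hB => by
  have hp : invComb τ n α β z * aeval M pu = aeval M p := by
    rw [← h z M hA hB, Pi.mul_apply, hu z M hA hB]
  rw [map_sub, map_mul, map_mul _ (C α * pA - C β * pB), ← hp,
    ← invComb_mul_aeval_normPoly hA hB, mul_assoc, mul_assoc, ← map_mul, ← map_mul,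
    mul_comm pu, sub_self, Pi.zero_apply]

theorem invComb_mul_of_eq_add_smul_inv (hE : invComb τ n α β = v + γ • r) (hru : r * u = 1)
    (hv : IsPolyAlong pA pB v pv) (hu : IsPolyAlong pA pB u pu) :
    IsPolyAlong pA pB (invComb τ n α β * u) (pv * pu + C γ) := by
  rw [hE, add_mul, smul_mul_assoc, hru]
  simpa only [mul_one] using (hv.mul hu).add (one.smul γ)

end IsPolyAlong

/-! ### The family `(a, M)` with a scalar `a` -/

theorem natDegree_normPoly_C_X (hτ : τ ≠ 0) (a : k) : (normPoly τ (C a) X).natDegree = 2 := by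
  rw [normPoly, ← C_pow, natDegree_C_add, natDegree_C_mul_X_pow 2 τ hτ]

theorem irreducible_normPoly_C_X (hτ : Irreducible (X ^ 2 + C τ : k[X])) {a : k} (ha : a ≠ 0) :
    Irreducible (normPoly τ (C a) X) :=
  irreducible_normPoly hτ (natDegree_normPoly_C_X (tau_ne_zero hτ) a) (by simp [ha])

theorem eval_zero_C_mul_normPoly_C_X_ne_zero {a : k} (ha : a ≠ 0) :
    (C a * normPoly τ (C a) X).eval 0 ≠ 0 := by
  simp [eval_normPoly, ha]

theorem natDegree_C_mul_sub_C_mul_X_le_one (α β a : k) :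
    (C α * C a - C β * X : k[X]).natDegree ≤ 1 := by
  rw [← C_mul]
  compute_degree

theorem C_mul_sub_C_mul_X_ne_zero {α β a : k} (hαβ : α ≠ 0 ∨ β ≠ 0) (ha : a ≠ 0) :
    (C α * C a - C β * X : k[X]) ≠ 0 := fun h => by
  have hcoeff₀ : α * a = 0 := by simpa using congrArg (coeff · 0) h
  have hcoeff₁ : β = 0 := by simpa [coeff_C] using congrArg (coeff · 1) h
  exact hαβ.elim (· ((mul_eq_zero.mp hcoeff₀).resolve_right ha)) (· hcoeff₁)

namespace IsPolyAlong

variable {p : k[X]} {u r : InputFun τ n} {a : k}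

theorem eq_zero_of_scalar (hτ : Irreducible (X ^ 2 + C τ : k[X])) (hn : 2 ≤ n) (ha : a ≠ 0)
    (h : IsPolyAlong (C a) X (0 : InputFun τ n) p) (hp : p.natDegree ≤ 7) : p = 0 := by
  have hirr := irreducible_normPoly_C_X hτ ha
  have hdeg := natDegree_normPoly_C_X (tau_ne_zero hτ) a
  suffices p * normPoly τ (C a) X = 0 from (mul_eq_zero.mp this).resolve_right hirr.ne_zero
  refine eq_zero_of_natDegree_le_nine hτ (natDegree_mul_le.trans (by omega)) fun m hm hm2 _ => ?_
  rcases hirr.isCoprime_or_dvd m with hco | hdvd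
  · refine (h.dvd_of_zero hn hm hm2 ?_ (eval_zero_C_mul_normPoly_C_X_ne_zero ha)).mul_right _
    exact (isCoprime_mul_unit_left_left (isUnit_C.mpr ha.isUnit) _ _).mpr hco
  · exact (associated_of_dvd_of_natDegree_le hdvd hm.ne_zero (by omega)).symm.dvd.mul_left _

theorem eq_C_or_eq_C_mul_of_scalar_unit (hτ : Irreducible (X ^ 2 + C τ : k[X])) (hn : 2 ≤ n)
    (ha : a ≠ 0) (hu : IsPolyAlong (C a) X u p) (hur : u * r = 1) (hp : p.natDegree ≤ 2) :
    ∃ c : k, c ≠ 0 ∧ (p = C c ∨ p = C c * normPoly τ (C a) X) := by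
  have hirr := irreducible_normPoly_C_X hτ ha
  have hdvd {q : k[X]} (hq : q.Monic) (hqirr : Irreducible q) (hq2 : q.natDegree ≤ 2)
      (hqp : q ∣ p) : q ∣ normPoly τ (C a) X :=
    (isUnit_C.mpr ha.isUnit).dvd_mul_left.mp (hu.dvd_of_mul_eq_one hn hur hq hqirr hq2 hqp
      (eval_zero_C_mul_normPoly_C_X_ne_zero ha))
  have hp0 : p ≠ 0 := by
    rintro rfl
    have hX := hdvd monic_X irreducible_X (natDegree_X_le.trans one_le_two) (dvd_zero X)
    simp [X_dvd_iff, coeff_zero_eq_eval_zero, eval_normPoly, ha] at hX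
  by_cases hunit : IsUnit p
  · obtain ⟨c, hc, rfl⟩ := isUnit_iff.mp hunit
    exact ⟨c, hc.ne_zero, Or.inl rfl⟩
  · obtain ⟨q, hq, hqirr, hqp⟩ := exists_monic_irreducible_factor p hunit
    have hQp := (hqirr.dvd_symm hirr
      (hdvd hq hqirr ((natDegree_le_of_dvd hqp hp0).trans hp) hqp)).trans hqp
    obtain ⟨w, hw⟩ := associated_of_dvd_of_natDegree_le hQp hp0
      (by rwa [natDegree_normPoly_C_X (tau_ne_zero hτ)])
    obtain ⟨c, hc, hcw⟩ := isUnit_iff.mp w.isUnit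
    exact ⟨c, hc.ne_zero, Or.inr (by rw [← hw, ← hcw, mul_comm])⟩

theorem exists_scalar_inv_eq_C (hτ : Irreducible (X ^ 2 + C τ : k[X])) (hn : 2 ≤ n)
    (ha : a ≠ 0) (hu : IsPolyAlong (C a) X u p) (hur : u * r = 1) (hp : p.natDegree ≤ 1) :
    ∃ c : k, IsPolyAlong (C a) X r (C c) := by
  obtain ⟨c, hc, rfl | rfl⟩ := hu.eq_C_or_eq_C_mul_of_scalar_unit hτ hn ha hur (by omega)
  · exact ⟨_, hu.inv_of_const hc hur⟩
  · rw [natDegree_C_mul hc, natDegree_normPoly_C_X (tau_ne_zero hτ)] at hp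
    omega

theorem not_invComb_scalar (hτ : Irreducible (X ^ 2 + C τ : k[X])) (hn : 2 ≤ n) (ha : a ≠ 0)
    {α β : k} (hαβ : α ≠ 0 ∨ β ≠ 0) (hp : p.natDegree ≤ 5) :
    ¬ IsPolyAlong (C a) X (invComb τ n α β) p := fun h => by
  have hl := natDegree_C_mul_sub_C_mul_X_le_one α β a
  have hQ := natDegree_normPoly_C_X (tau_ne_zero hτ) a
  have h' : IsPolyAlong (C a) X (invComb τ n α β * 1) p := by rwa [mul_one]
  have hzero := one.zero_of_invComb_mul h'
  rw [mul_one] at hzero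
  have heq := sub_eq_zero.mp (hzero.eq_zero_of_scalar hτ hn ha ((natDegree_sub_le _ _).trans
    (max_le (natDegree_mul_le.trans (by omega)) (by omega))))
  exact C_mul_sub_C_mul_X_ne_zero hαβ ha
    (eq_zero_of_dvd_of_natDegree_lt (Dvd.intro_left p heq) (by omega))

end IsPolyAlong

/-! ### The family `(M, s M)` with a scalar `s` -/

theorem normPoly_X_C_mul_X (τ s : k) : normPoly τ X (C s * X) = C (1 + τ * s ^ 2) * X ^ 2 := by
  simp only [normPoly, C_add, C_mul, C_pow, C_1]
  ring

theorem X_mul_normPoly_X_C_mul_X (τ s : k) :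
    X * normPoly τ X (C s * X) = C (1 + τ * s ^ 2) * X ^ 3 := by
  rw [normPoly_X_C_mul_X]
  ring

theorem eval_one_X_mul_normPoly_ne_zero (hτ : Irreducible (X ^ 2 + C τ : k[X])) (s : k) :
    (X * normPoly τ X (C s * X)).eval 1 ≠ 0 := by
  simpa [X_mul_normPoly_X_C_mul_X] using one_add_mul_sq_ne_zero hτ s

namespace IsPolyAlong

variable {p q : k[X]} {u r : InputFun τ n} {s : k}

theorem of_X_mul {pB : k[X]} (h : IsPolyAlong X pB (0 : InputFun τ n) (X * p)) :
    IsPolyAlong X pB (0 : InputFun τ n) p := fun z M hA hB => by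
  have hX : IsUnit (aeval M (X : k[X])) := hA ▸ z.2.1
  exact (hX.mul_right_eq_zero.mp ((map_mul _ _ _).symm.trans (h z M hA hB).symm)).symm

theorem eq_zero_of_proportional (hτ : Irreducible (X ^ 2 + C τ : k[X])) (hn : 2 ≤ n)
    (h : IsPolyAlong X (C s * X) (0 : InputFun τ n) p) (hp : p.natDegree ≤ 9) : p = 0 := by
  refine eq_zero_of_natDegree_le_nine hτ hp fun m hm hm2 hm0 =>
    h.dvd_of_zero hn hm hm2 ?_ (eval_one_X_mul_normPoly_ne_zero hτ s)
  have hX : IsCoprime X m := by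
    simpa only [C_0, sub_zero] using (isCoprime_X_sub_C_of_eval_ne_zero hm0).symm
  rw [X_mul_normPoly_X_C_mul_X]
  exact (isCoprime_mul_unit_left_left
    (isUnit_C.mpr (one_add_mul_sq_ne_zero hτ s).isUnit) _ _).mpr hX.pow_left

theorem eq_C_mul_X_pow_of_proportional_unit (hτ : Irreducible (X ^ 2 + C τ : k[X]))
    (hn : 2 ≤ n) (hu : IsPolyAlong X (C s * X) u p) (hur : u * r = 1) (hp : p.natDegree ≤ 2) :
    ∃ (c : k) (j : ℕ), p = C c * X ^ j := by
  by_cases hp0 : p = 0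
  · exact ⟨0, 0, by simp [hp0]⟩
  obtain ⟨p', hp', hX⟩ := exists_eq_pow_rootMultiplicity_mul_and_not_dvd p hp0 0
  rw [C_0, sub_zero] at hp' hX
  by_cases hunit : IsUnit p'
  · obtain ⟨c, -, rfl⟩ := isUnit_iff.mp hunit
    exact ⟨c, _, hp'.trans (mul_comm _ _)⟩
  · obtain ⟨q, hq, hqirr, hqp'⟩ := exists_monic_irreducible_factor p' hunit
    have hqp : q ∣ p := hp' ▸ hqp'.mul_left _
    have hqX := hu.dvd_of_mul_eq_one hn hur hq hqirr ((natDegree_le_of_dvd hqp hp0).trans hp) hqp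
      (eval_one_X_mul_normPoly_ne_zero hτ s)
    rw [X_mul_normPoly_X_C_mul_X,
      (isUnit_C.mpr (one_add_mul_sq_ne_zero hτ s).isUnit).dvd_mul_left] at hqX
    exact absurd ((hqirr.dvd_symm irreducible_X (hqirr.prime.dvd_of_dvd_pow hqX)).trans hqp') hX

theorem mul_eq_mul_of_invComb_mul_proportional (hτ : Irreducible (X ^ 2 + C τ : k[X]))
    (hn : 2 ≤ n) {α β : k} (hu : IsPolyAlong X (C s * X) u q)
    (h : IsPolyAlong X (C s * X) (invComb τ n α β * u) p) (hp : p.natDegree ≤ 8)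
    (hq : q.natDegree ≤ 9) : C (1 + τ * s ^ 2) * (X * p) = C (α - β * s) * q := by
  refine sub_eq_zero.mp (eq_zero_of_proportional hτ hn (s := s) (n := n) (of_X_mul ?_) ?_)
  · convert zero_of_invComb_mul hu h using 1
    rw [normPoly_X_C_mul_X, C_sub, C_mul]
    ring
  · refine (natDegree_sub_le _ _).trans (max_le ((natDegree_C_mul_le _ _).trans ?_)
      ((natDegree_C_mul_le _ _).trans hq))
    exact natDegree_mul_le.trans (by rw [natDegree_X]; omega)

end IsPolyAlong

/-! ### Spans of registers along the two families -/

/-- The span of the registers that are available before the first counted instruction. -/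
def baseSpan (τ : k) (n : ℕ) : Submodule k (InputFun τ n) :=
  Submodule.span k {1, re τ n, im τ n}

theorem one_mem_baseSpan : (1 : InputFun τ n) ∈ baseSpan τ n := Submodule.subset_span (by simp)

theorem re_mem_baseSpan : re τ n ∈ baseSpan τ n := Submodule.subset_span (by simp)

theorem im_mem_baseSpan : im τ n ∈ baseSpan τ n := Submodule.subset_span (by simp)

theorem exists_isPolyAlong_of_mem_baseSpan {f : InputFun τ n} (hf : f ∈ baseSpan τ n) :
    ∃ c₀ c₁ c₂ : k, ∀ pA pB, IsPolyAlong pA pB f (C c₀ + C c₁ * pA + C c₂ * pB) := by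
  obtain ⟨c₀, c₁, c₂, rfl⟩ := Submodule.mem_span_triple.mp hf
  refine ⟨c₀, c₁, c₂, fun pA pB => ?_⟩
  simpa only [mul_one] using
    ((IsPolyAlong.one.smul c₀).add (IsPolyAlong.re.smul c₁)).add (IsPolyAlong.im.smul c₂)

/-- Along each family `(a, M)` with a scalar `a ≠ 0`, every member of `V` is a polynomial in `M` of
degree at most `d` whose coefficient of degree `d` does not depend on `a`. -/
def ScalarFamilyBound (d : ℕ) (V : Submodule k (InputFun τ n)) : Prop :=
  ∀ f ∈ V, ∃ c : k, ∀ a : k, a ≠ 0 →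
    ∃ p : k[X], p.natDegree ≤ d ∧ p.coeff d = c ∧ IsPolyAlong (C a) X f p

/-- Along each family `(M, s M)` with a scalar `s`, every member of `V` is a polynomial in `M` of
degree at most `d` whose coefficients of degrees `0` and `1` are constant and affine in `s`. -/
def ProportionalFamilyBound (d : ℕ) (V : Submodule k (InputFun τ n)) : Prop :=
  ∀ f ∈ V, ∃ c₀ c₁ c₂ : k, ∀ s : k, ∃ p : k[X], p.natDegree ≤ d ∧ p.coeff 0 = c₀ ∧
    p.coeff 1 = c₁ + c₂ * s ∧ IsPolyAlong X (C s * X) f p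

theorem scalarFamilyBound_baseSpan : ScalarFamilyBound 1 (baseSpan τ n) := by
  intro f hf
  obtain ⟨c₀, c₁, c₂, h⟩ := exists_isPolyAlong_of_mem_baseSpan hf
  refine ⟨c₂, fun a _ => ⟨_, ?_, ?_, h (C a) X⟩⟩
  · rw [← C_mul, ← C_add]
    compute_degree
  · simp [coeff_C]

theorem proportionalFamilyBound_baseSpan : ProportionalFamilyBound 1 (baseSpan τ n) := by
  intro f hf
  obtain ⟨c₀, c₁, c₂, h⟩ := exists_isPolyAlong_of_mem_baseSpan hf
  refine ⟨c₀, c₁, c₂, fun s => ⟨_, ?_, ?_, ?_, h X (C s * X)⟩⟩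
  · compute_degree
  · simp
  · simp [coeff_C]

section Extend

variable {V : Submodule k (InputFun τ n)} {u v r : InputFun τ n} {d e : ℕ}

theorem natDegree_add_C_mul_le {p q : k[X]} (hp : p.natDegree ≤ d) (hq : q.natDegree ≤ d) (γ : k) :
    (p + C γ * q).natDegree ≤ d :=
  (natDegree_add_le _ _).trans (max_le hp ((natDegree_C_mul_le _ _).trans hq))

theorem ScalarFamilyBound.mono (h : ScalarFamilyBound d V) (hde : d < e) :
    ScalarFamilyBound e V := by
  intro f hf
  obtain ⟨_, hf⟩ := h f hf
  refine ⟨0, fun a ha => ?_⟩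
  obtain ⟨p, hp, -, hfp⟩ := hf a ha
  exact ⟨p, by omega, coeff_eq_zero_of_natDegree_lt (by omega), hfp⟩

theorem ScalarFamilyBound.sup_mul (h : ScalarFamilyBound d V) (hd : d ≠ 0) (hu : u ∈ V)
    (hv : v ∈ V) : ScalarFamilyBound (d + d) (V ⊔ k ∙ (u * v)) := by
  intro f hf
  obtain ⟨w, hw, γ, rfl⟩ := mem_sup_span_singleton.mp hf
  obtain ⟨cu, hu⟩ := h u hu
  obtain ⟨cv, hv⟩ := h v hv
  obtain ⟨_, hw⟩ := h w hw
  refine ⟨γ * (cu * cv), fun a ha => ?_⟩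
  obtain ⟨pu, hdu, hcu, hpu⟩ := hu a ha
  obtain ⟨pv, hdv, hcv, hpv⟩ := hv a ha
  obtain ⟨pw, hdw, -, hpw⟩ := hw a ha
  refine ⟨_, ?_, ?_, hpw.add ((hpu.mul hpv).smul γ)⟩
  · exact natDegree_add_C_mul_le (by omega) (natDegree_mul_le.trans (by omega)) γ
  · rw [coeff_add, coeff_eq_zero_of_natDegree_lt (by omega), zero_add, coeff_C_mul,
      coeff_mul_add_eq_of_natDegree_le hdu hdv, hcu, hcv]

theorem ScalarFamilyBound.sup_const (h : ScalarFamilyBound d V) (hd : d ≠ 0)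
    (hr : ∀ a : k, a ≠ 0 → ∃ c : k, IsPolyAlong (C a) X r (C c)) :
    ScalarFamilyBound d (V ⊔ k ∙ r) := by
  intro f hf
  obtain ⟨w, hw, γ, rfl⟩ := mem_sup_span_singleton.mp hf
  obtain ⟨cw, hw⟩ := h w hw
  refine ⟨cw, fun a ha => ?_⟩
  obtain ⟨pw, hdw, hcw, hpw⟩ := hw a ha
  obtain ⟨c, hc⟩ := hr a ha
  refine ⟨_, ?_, ?_, hpw.add (hc.smul γ)⟩
  · exact natDegree_add_C_mul_le hdw (by rw [natDegree_C]; omega) γ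
  · rw [← C_mul, coeff_add, coeff_C_of_ne_zero hd, add_zero, hcw]

theorem ProportionalFamilyBound.mono (h : ProportionalFamilyBound d V) (hde : d ≤ e) :
    ProportionalFamilyBound e V := by
  intro f hf
  obtain ⟨c₀, c₁, c₂, h⟩ := h f hf
  refine ⟨c₀, c₁, c₂, fun s => ?_⟩
  obtain ⟨p, hp, h⟩ := h s
  exact ⟨p, hp.trans hde, h⟩

theorem ProportionalFamilyBound.sup_mul (h : ProportionalFamilyBound d V) (hu : u ∈ V)
    (hv : v ∈ V) : ProportionalFamilyBound (d + d) (V ⊔ k ∙ (u * v)) := by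
  intro f hf
  obtain ⟨w, hw, γ, rfl⟩ := mem_sup_span_singleton.mp hf
  obtain ⟨u₀, u₁, u₂, hu⟩ := h u hu
  obtain ⟨v₀, v₁, v₂, hv⟩ := h v hv
  obtain ⟨w₀, w₁, w₂, hw⟩ := h w hw
  refine ⟨w₀ + γ * (u₀ * v₀), w₁ + γ * (u₀ * v₁ + u₁ * v₀), w₂ + γ * (u₀ * v₂ + u₂ * v₀),
    fun s => ?_⟩
  obtain ⟨pu, hdu, hu₀, hu₁, hpu⟩ := hu s
  obtain ⟨pv, hdv, hv₀, hv₁, hpv⟩ := hv s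
  obtain ⟨pw, hdw, hw₀, hw₁, hpw⟩ := hw s
  refine ⟨_, ?_, ?_, ?_, hpw.add ((hpu.mul hpv).smul γ)⟩
  · exact natDegree_add_C_mul_le (by omega) (natDegree_mul_le.trans (by omega)) γ
  · rw [coeff_add, coeff_C_mul, mul_coeff_zero, hu₀, hv₀, hw₀]
  · rw [coeff_add, coeff_C_mul, mul_coeff_one, hu₀, hv₀, hu₁, hv₁, hw₁]
    ring

theorem ScalarFamilyBound.sup_inv (hτ : Irreducible (X ^ 2 + C τ : k[X])) (hn : 2 ≤ n)
    (h : ScalarFamilyBound 1 V) (hu : u ∈ V) (hur : u * r = 1) :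
    ScalarFamilyBound 1 (V ⊔ k ∙ r) := by
  refine h.sup_const one_ne_zero fun a ha => ?_
  obtain ⟨_, hu⟩ := h u hu
  obtain ⟨p, hp, -, hup⟩ := hu a ha
  exact hup.exists_scalar_inv_eq_C hτ hn ha hur hp

end Extend

/-! ### Inverting after one multiplication -/

theorem exists_isPolyAlong_of_mem_baseSpan_sup_mul {ℓ₁ ℓ₂ u : InputFun τ n}
    (h₁ : ℓ₁ ∈ baseSpan τ n) (h₂ : ℓ₂ ∈ baseSpan τ n) (hu : u ∈ baseSpan τ n ⊔ k ∙ (ℓ₁ * ℓ₂)) :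
    ∃ e₀ e₁ e₂ γ b₁ b₂ d₁ d₂ : k, ∀ pA pB, IsPolyAlong pA pB u
      (C e₀ + C e₁ * pA + C e₂ * pB + C γ * (C b₁ * pA + C b₂ * pB) * (C d₁ * pA + C d₂ * pB)) := by
  obtain ⟨ℓ, hℓ, γ, rfl⟩ := mem_sup_span_singleton.mp hu
  obtain ⟨a₀, a₁, a₂, ha⟩ := exists_isPolyAlong_of_mem_baseSpan hℓ
  obtain ⟨b₀, b₁, b₂, hb⟩ := exists_isPolyAlong_of_mem_baseSpan h₁
  obtain ⟨d₀, d₁, d₂, hd⟩ := exists_isPolyAlong_of_mem_baseSpan h₂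
  refine ⟨a₀ + γ * b₀ * d₀, a₁ + γ * (b₀ * d₁ + b₁ * d₀), a₂ + γ * (b₀ * d₂ + b₂ * d₀),
    γ, b₁, b₂, d₁, d₂, fun pA pB => ?_⟩
  convert (ha pA pB).add (((hb pA pB).mul (hd pA pB)).smul γ) using 1
  simp only [C_add, C_mul]
  ring

namespace IsPolyAlong

variable {u r : InputFun τ n} {a s c₀ c₁ c₂ : k}

theorem quadratic_of_scalar_unit (hτ : Irreducible (X ^ 2 + C τ : k[X])) (hn : 2 ≤ n) (ha : a ≠ 0)
    (hu : IsPolyAlong (C a) X u (C c₂ * X ^ 2 + C c₁ * X + C c₀)) (hur : u * r = 1) :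
    c₁ = 0 ∧ (c₂ = 0 ∨ τ * c₀ = c₂ * a ^ 2) := by
  obtain ⟨c, -, h | h⟩ :=
    hu.eq_C_or_eq_C_mul_of_scalar_unit hτ hn ha hur natDegree_quadratic_le
  · have hcoeff₁ : c₁ = 0 := by simpa [coeff_C] using congrArg (coeff · 1) h
    have hcoeff₂ : c₂ = 0 := by simpa [coeff_X, coeff_C] using congrArg (coeff · 2) h
    exact ⟨hcoeff₁, Or.inl hcoeff₂⟩
  · rw [normPoly, ← C_pow] at h
    have hcoeff₀ : c₀ = c * a ^ 2 := by simpa [-map_pow] using congrArg (coeff · 0) h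
    have hcoeff₁ : c₁ = 0 := by simpa [coeff_C, -map_pow] using congrArg (coeff · 1) h
    have hcoeff₂ : c₂ = c * τ := by
      simpa [coeff_X, coeff_C, -map_pow] using congrArg (coeff · 2) h
    exact ⟨hcoeff₁, Or.inr (by rw [hcoeff₀, hcoeff₂]; ring)⟩

theorem quadratic_of_proportional_unit (hτ : Irreducible (X ^ 2 + C τ : k[X])) (hn : 2 ≤ n)
    (hu : IsPolyAlong X (C s * X) u (C c₂ * X ^ 2 + C c₁ * X + C c₀)) (hur : u * r = 1) :
    c₀ * c₂ = 0 ∧ c₁ * c₂ = 0 := by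
  obtain ⟨c, j, h⟩ := hu.eq_C_mul_X_pow_of_proportional_unit hτ hn hur natDegree_quadratic_le
  have hcoeff₀ : c₀ = if 0 = j then c else 0 := by
    simpa [coeff_X_pow] using congrArg (coeff · 0) h
  have hcoeff₁ : c₁ = if 1 = j then c else 0 := by
    simpa [coeff_C, coeff_X_pow] using congrArg (coeff · 1) h
  have hcoeff₂ : c₂ = if 2 = j then c else 0 := by
    simpa [coeff_X, coeff_C, coeff_X_pow] using congrArg (coeff · 2) h
  rw [hcoeff₀, hcoeff₁, hcoeff₂]
  constructor <;> split_ifs <;> first | omega | simp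

end IsPolyAlong

/- The relations say that the quadratic form `γ ℓ₁ ℓ₂` is a multiple of the norm form, which is
anisotropic and hence not a product of linear forms. -/
theorem leadingCoeff_eq_zero_of_unit_relations (hτ : Irreducible (X ^ 2 + C τ : k[X]))
    {e₀ e₁ e₂ γ b₁ b₂ d₁ d₂ : k}
    (hscalar : ∀ a ≠ 0, e₂ + γ * (b₁ * d₂ + b₂ * d₁) * a = 0 ∧
      (γ * b₂ * d₂ = 0 ∨ τ * (e₀ + e₁ * a + γ * b₁ * d₁ * a ^ 2) = γ * b₂ * d₂ * a ^ 2))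
    (hprop : ∀ s, e₀ * (γ * (b₁ + b₂ * s) * (d₁ + d₂ * s)) = 0 ∧
      (e₁ + e₂ * s) * (γ * (b₁ + b₂ * s) * (d₁ + d₂ * s)) = 0) :
    γ * b₂ * d₂ = 0 := by
  by_contra hlead
  obtain ⟨t, ht0, ht1⟩ := exists_ne_zero_ne_one hτ
  have hmixed : γ * (b₁ * d₂ + b₂ * d₁) = 0 := by
    have h : (t - 1) * (γ * (b₁ * d₂ + b₂ * d₁)) = 0 := by
      linear_combination (hscalar t ht0).1 - (hscalar 1 one_ne_zero).1
    exact (mul_eq_zero.mp h).resolve_left (sub_ne_zero.mpr ht1)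
  have he₂ : e₂ = 0 := by linear_combination (hscalar 1 one_ne_zero).1 - hmixed
  have he₀ : e₀ = 0 := by
    have h : e₀ * (γ * b₂ * d₂) = 0 := by
      linear_combination (hprop 1).1 - (hprop 0).1 - e₀ * hmixed
    exact (mul_eq_zero.mp h).resolve_right hlead
  have he₁ : e₁ = 0 := by
    have h : e₁ * (γ * b₂ * d₂) = 0 := by
      linear_combination (hprop 1).2 - (hprop 0).2 - e₁ * hmixed -
        γ * (b₁ + b₂) * (d₁ + d₂) * he₂
    exact (mul_eq_zero.mp h).resolve_right hlead
  have hnorm : τ * (γ * b₁ * d₁) = γ * b₂ * d₂ := by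
    linear_combination (hscalar 1 one_ne_zero).2.resolve_left hlead - τ * he₀ - τ * he₁
  have hγd₁ : γ * d₁ ≠ 0 := fun h => hlead (by linear_combination τ * b₁ * h - hnorm)
  have hb₁ : b₁ ≠ 0 := fun h => hlead (by linear_combination τ * γ * d₁ * h - hnorm)
  have hzero : γ * d₁ * (b₂ ^ 2 + τ * b₁ ^ 2) = 0 := by
    linear_combination b₂ * hmixed + b₁ * hnorm
  exact hb₁
    (eq_zero_of_sq_add_mul_sq_eq_zero hτ ((mul_eq_zero.mp hzero).resolve_left hγd₁)).2

theorem exists_isPolyAlong_inv_of_mem_baseSpan_sup_mul (hτ : Irreducible (X ^ 2 + C τ : k[X]))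
    (hn : 2 ≤ n) {ℓ₁ ℓ₂ u r : InputFun τ n} (h₁ : ℓ₁ ∈ baseSpan τ n) (h₂ : ℓ₂ ∈ baseSpan τ n)
    (hu : u ∈ baseSpan τ n ⊔ k ∙ (ℓ₁ * ℓ₂)) (hur : u * r = 1) {a : k} (ha : a ≠ 0) :
    ∃ c : k, IsPolyAlong (C a) X r (C c) := by
  obtain ⟨e₀, e₁, e₂, γ, b₁, b₂, d₁, d₂, hpoly⟩ :=
    exists_isPolyAlong_of_mem_baseSpan_sup_mul h₁ h₂ hu
  have hscalar (a : k) : IsPolyAlong (C a) X u (C (γ * b₂ * d₂) * X ^ 2 +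
      C (e₂ + γ * (b₁ * d₂ + b₂ * d₁) * a) * X + C (e₀ + e₁ * a + γ * b₁ * d₁ * a ^ 2)) := by
    convert hpoly (C a) X using 1
    simp only [C_add, C_mul, C_pow]
    ring
  have hprop (s : k) : IsPolyAlong X (C s * X) u
      (C (γ * (b₁ + b₂ * s) * (d₁ + d₂ * s)) * X ^ 2 + C (e₁ + e₂ * s) * X + C e₀) := by
    convert hpoly X (C s * X) using 1
    simp only [C_add, C_mul]
    ring
  have hlead : γ * b₂ * d₂ = 0 := leadingCoeff_eq_zero_of_unit_relations hτ
    (fun a ha => (hscalar a).quadratic_of_scalar_unit hτ hn ha hur)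
    (fun s => (hprop s).quadratic_of_proportional_unit hτ hn hur)
  refine (hscalar a).exists_scalar_inv_eq_C hτ hn ha hur ?_
  rw [hlead, C_0, zero_mul, zero_add]
  exact natDegree_linear_le

/-! ### The lower bound for multiplications and inversions -/

theorem eq_C_of_sub_mul_mul_eq {Q l pu pv : k[X]} {γ : k} (hQ : Irreducible Q) (hl : l ≠ 0)
    (hdeg : l.natDegree < Q.natDegree) (hγ : γ ≠ 0) (h : (l - pv * Q) * pu = C γ * Q) :
    ∃ e c : k, e * c = γ ∧ l = C e ∧ pu = C c * Q := by
  have hndvd : ¬ Q ∣ l - pv * Q := fun hdvd => hl <|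
    eq_zero_of_dvd_of_natDegree_lt ((dvd_sub_left (dvd_mul_left Q pv)).mp hdvd) hdeg
  obtain ⟨q, rfl⟩ := (hQ.prime.dvd_or_dvd (Dvd.intro_left _ h.symm)).resolve_left hndvd
  have hγq : (l - pv * Q) * q = C γ := mul_left_cancel₀ hQ.ne_zero (by linear_combination h)
  have hunit : IsUnit ((l - pv * Q) * q) := hγq ▸ isUnit_C.mpr hγ.isUnit
  obtain ⟨e, -, he⟩ := isUnit_iff.mp (isUnit_of_mul_isUnit_left hunit)
  obtain ⟨c, -, rfl⟩ := isUnit_iff.mp (isUnit_of_mul_isUnit_right hunit)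
  refine ⟨e, c, ?_, ?_, mul_comm _ _⟩
  · rwa [← he, ← C_mul, C_inj] at hγq
  · refine sub_eq_zero.mp (eq_zero_of_dvd_of_natDegree_lt (p := Q) ⟨pv, ?_⟩ ?_)
    · rw [he]
      ring
    · rwa [natDegree_sub_C]

theorem IsPolyAlong.coeff_two_mul_of_scalar (hτ : Irreducible (X ^ 2 + C τ : k[X])) (hn : 2 ≤ n)
    {a α β γ : k} (ha : a ≠ 0) (hαβ : α ≠ 0 ∨ β ≠ 0) (hγ : γ ≠ 0) {u v r : InputFun τ n}
    (hE : invComb τ n α β = v + γ • r) (hru : r * u = 1) {pu pv : k[X]}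
    (hu : IsPolyAlong (C a) X u pu) (hv : IsPolyAlong (C a) X v pv) (hdu : pu.natDegree ≤ 2)
    (hdv : pv.natDegree ≤ 2) : pu.coeff 2 * (α * a) = γ * τ := by
  have hdl := natDegree_C_mul_sub_C_mul_X_le_one α β a
  have hdQ := natDegree_normPoly_C_X (tau_ne_zero hτ) a
  have hdp : (pv * pu + C γ).natDegree ≤ 4 := by
    rw [natDegree_add_C]
    exact natDegree_mul_le.trans (by omega)
  have hzero := hu.zero_of_invComb_mul (invComb_mul_of_eq_add_smul_inv hE hru hv hu)
  have hpoly := hzero.eq_zero_of_scalar hτ hn ha ((natDegree_sub_le _ _).trans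
    (max_le (natDegree_mul_le.trans (by omega)) (natDegree_mul_le.trans (by omega))))
  obtain ⟨e, c, hec, hl, rfl⟩ := eq_C_of_sub_mul_mul_eq (irreducible_normPoly_C_X hτ ha)
    (C_mul_sub_C_mul_X_ne_zero hαβ ha) (by omega) hγ
    (show (C α * C a - C β * X - pv * normPoly τ (C a) X) * pu = C γ * normPoly τ (C a) X by
      linear_combination -hpoly)
  have hαa : α * a = e := by simpa using congrArg (coeff · 0) hl
  have hcoeff : (C c * normPoly τ (C a) X).coeff 2 = c * τ := by
    rw [normPoly, ← C_pow, coeff_C_mul, coeff_add, coeff_C_of_ne_zero two_ne_zero, zero_add,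
      coeff_C_mul, coeff_X_pow_self, mul_one]
  rw [hcoeff, hαa, ← hec]
  ring

/- `hcoeff₀` forces `u₀ = 0`; then `γ (1 + τ s²) = (α - β s) (u₁ + u₂ s)`, and since `1 + τ s²` has
no zeros, `β = 0`. -/
theorem eq_zero_of_proportional_inv_relations (hτ : Irreducible (X ^ 2 + C τ : k[X]))
    {α β γ u₀ u₁ u₂ v₀ : k} (hαβ : α ≠ 0 ∨ β ≠ 0) (hcoeff₀ : ∀ s, (α - β * s) * u₀ = 0)
    (hcoeff₁ : ∀ s, (1 + τ * s ^ 2) * (v₀ * u₀ + γ) = (α - β * s) * (u₁ + u₂ * s)) : γ = 0 := by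
  by_contra hγ
  have hu₀ : u₀ = 0 := by
    by_contra hu₀
    have hα : α = 0 := by simpa [hu₀] using hcoeff₀ 0
    have hβ : β = 0 := by simpa [hu₀, hα] using hcoeff₀ 1
    exact hαβ.elim (· hα) (· hβ)
  subst hu₀
  have hβ : β = 0 := by
    by_contra hβ
    have h := hcoeff₁ (α / β)
    rw [mul_div_cancel₀ _ hβ, sub_self, zero_mul, mul_zero, zero_add] at h
    exact mul_ne_zero (one_add_mul_sq_ne_zero hτ _) hγ h
  subst hβ
  obtain ⟨t, ht0, ht1⟩ := exists_ne_zero_ne_one hτ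
  -- The second difference at `0, 1, t` of the quadratic left side is that of an affine function.
  have h : τ * γ * (t * (t - 1)) = 0 := by
    linear_combination hcoeff₁ t - t * hcoeff₁ 1 + (t - 1) * hcoeff₁ 0
  exact mul_ne_zero (mul_ne_zero (tau_ne_zero hτ) hγ) (mul_ne_zero ht0 (sub_ne_zero.mpr ht1)) h

section LastStep

variable {V W : Submodule k (InputFun τ n)} {u r : InputFun τ n} {α β : k}

theorem ScalarFamilyBound.invComb_notMem (hτ : Irreducible (X ^ 2 + C τ : k[X])) (hn : 2 ≤ n)
    (h : ScalarFamilyBound 4 V) (hαβ : α ≠ 0 ∨ β ≠ 0) : invComb τ n α β ∉ V := fun hE => by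
  obtain ⟨_, hE⟩ := h _ hE
  obtain ⟨p, hp, -, hEp⟩ := hE 1 one_ne_zero
  exact IsPolyAlong.not_invComb_scalar hτ hn one_ne_zero hαβ (by omega) hEp

theorem ScalarFamilyBound.invComb_notMem_sup_inv (hτ : Irreducible (X ^ 2 + C τ : k[X]))
    (hn : 2 ≤ n) (h : ScalarFamilyBound 2 V) (hαβ : α ≠ 0 ∨ β ≠ 0) (hu : u ∈ V)
    (hru : r * u = 1) : invComb τ n α β ∉ V ⊔ k ∙ r := fun hE => by
  obtain ⟨v, hv, γ, hE⟩ := mem_sup_span_singleton.mp hE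
  have hγ : γ ≠ 0 := by
    rintro rfl
    rw [zero_smul, add_zero] at hE
    exact (h.mono (by norm_num)).invComb_notMem hτ hn hαβ (hE ▸ hv)
  obtain ⟨c, hu⟩ := h u hu
  obtain ⟨_, hv⟩ := h v hv
  have hcoeff (a : k) (ha : a ≠ 0) : c * (α * a) = γ * τ := by
    obtain ⟨pu, hdu, hcu, hpu⟩ := hu a ha
    obtain ⟨pv, hdv, -, hpv⟩ := hv a ha
    exact hcu ▸ hpu.coeff_two_mul_of_scalar hτ hn ha hαβ hγ hE hru hpv hdu hdv
  obtain ⟨t, ht0, ht1⟩ := exists_ne_zero_ne_one hτ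
  have hzero : γ * τ * (t - 1) = 0 := by
    linear_combination hcoeff t ht0 - t * hcoeff 1 one_ne_zero
  exact mul_ne_zero (mul_ne_zero hγ (tau_ne_zero hτ)) (sub_ne_zero.mpr ht1) hzero

theorem ProportionalFamilyBound.invComb_notMem (hτ : Irreducible (X ^ 2 + C τ : k[X]))
    (hn : 2 ≤ n) (h : ProportionalFamilyBound 8 V) (hαβ : α ≠ 0 ∨ β ≠ 0) :
    invComb τ n α β ∉ V := fun hE => by
  obtain ⟨_, _, _, hE⟩ := h _ hE
  have hzero (s : k) : α - β * s = 0 := by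
    obtain ⟨p, hp, -, -, hEp⟩ := hE s
    have hpoly := IsPolyAlong.one.mul_eq_mul_of_invComb_mul_proportional hτ hn
      (by rwa [mul_one]) hp (by simp)
    simpa using (congrArg (coeff · 0) hpoly).symm
  have hα : α = 0 := by simpa using hzero 0
  have hβ : β = 0 := by simpa [hα] using hzero 1
  exact hαβ.elim (· hα) (· hβ)

theorem ProportionalFamilyBound.invComb_notMem_sup_inv (hτ : Irreducible (X ^ 2 + C τ : k[X]))
    (hn : 2 ≤ n) (h : ProportionalFamilyBound 4 V) (hαβ : α ≠ 0 ∨ β ≠ 0) (hu : u ∈ V)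
    (hru : r * u = 1) : invComb τ n α β ∉ V ⊔ k ∙ r := fun hE => by
  obtain ⟨v, hv, γ, hE⟩ := mem_sup_span_singleton.mp hE
  obtain ⟨u₀, u₁, u₂, hu⟩ := h u hu
  obtain ⟨v₀, _, _, hv'⟩ := h v hv
  have hcoeff (s : k) : (α - β * s) * u₀ = 0 ∧
      (1 + τ * s ^ 2) * (v₀ * u₀ + γ) = (α - β * s) * (u₁ + u₂ * s) := by
    obtain ⟨pu, hdu, hu₀, hu₁, hpu⟩ := hu s
    obtain ⟨pv, hdv, hv₀, -, hpv⟩ := hv' s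
    have hpoly := hpu.mul_eq_mul_of_invComb_mul_proportional hτ hn
      (.invComb_mul_of_eq_add_smul_inv hE hru hpv hpu)
      (by rw [natDegree_add_C]; exact natDegree_mul_le.trans (by omega)) (by omega)
    have hpoly₀ := congrArg (coeff · 0) hpoly
    have hpoly₁ := congrArg (coeff · 1) hpoly
    simp only [coeff_C_mul, coeff_X_mul, coeff_add, mul_coeff_zero, coeff_X_zero,
      coeff_C_zero, zero_mul, mul_zero, hu₀, hv₀, hu₁] at hpoly₀ hpoly₁
    exact ⟨hpoly₀.symm, hpoly₁⟩
  have hγ : γ = 0 := eq_zero_of_proportional_inv_relations hτ hαβ (fun s => (hcoeff s).1)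
    fun s => (hcoeff s).2
  rw [hγ, zero_smul, add_zero] at hE
  exact (h.mono (by norm_num)).invComb_notMem hτ hn hαβ (hE ▸ hv)

theorem ScalarFamilyBound.invComb_notMem_of_step (hτ : Irreducible (X ^ 2 + C τ : k[X]))
    (hn : 2 ≤ n) (h : ScalarFamilyBound 2 V) (hαβ : α ≠ 0 ∨ β ≠ 0)
    (hstep : Step V W) : invComb τ n α β ∉ W := by
  obtain ⟨r, rfl, ⟨u, hu, v, hv, rfl⟩ | ⟨u, hu, -, hru⟩⟩ := hstep
  · exact (h.sup_mul two_ne_zero hu hv).invComb_notMem hτ hn hαβ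
  · exact h.invComb_notMem_sup_inv hτ hn hαβ hu hru

theorem ProportionalFamilyBound.invComb_notMem_of_step (hτ : Irreducible (X ^ 2 + C τ : k[X]))
    (hn : 2 ≤ n) (h : ProportionalFamilyBound 4 V) (hαβ : α ≠ 0 ∨ β ≠ 0)
    (hstep : Step V W) : invComb τ n α β ∉ W := by
  obtain ⟨r, rfl, ⟨u, hu, v, hv, rfl⟩ | ⟨u, hu, -, hru⟩⟩ := hstep
  · exact (h.sup_mul hu hv).invComb_notMem hτ hn hαβ
  · exact h.invComb_notMem_sup_inv hτ hn hαβ hu hru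

end LastStep

theorem familyBound_of_two_steps (hτ : Irreducible (X ^ 2 + C τ : k[X])) (hn : 2 ≤ n)
    {V₁ V₂ : Submodule k (InputFun τ n)} (hstep₁ : Step (baseSpan τ n) V₁)
    (hstep₂ : Step V₁ V₂) : ScalarFamilyBound 2 V₂ ∨ ProportionalFamilyBound 4 V₂ := by
  obtain ⟨r₁, rfl, ⟨u₁, hu₁, v₁, hv₁, rfl⟩ | ⟨u₁, hu₁, hur₁, -⟩⟩ := hstep₁ <;>
    obtain ⟨r₂, rfl, ⟨u₂, hu₂, v₂, hv₂, rfl⟩ | ⟨u₂, hu₂, hur₂, -⟩⟩ := hstep₂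
  · exact Or.inr ((proportionalFamilyBound_baseSpan.sup_mul hu₁ hv₁).sup_mul hu₂ hv₂)
  · exact Or.inl ((scalarFamilyBound_baseSpan.sup_mul one_ne_zero hu₁ hv₁).sup_const two_ne_zero
      fun _ => exists_isPolyAlong_inv_of_mem_baseSpan_sup_mul hτ hn hu₁ hv₁ hu₂ hur₂)
  · exact Or.inl ((scalarFamilyBound_baseSpan.sup_inv hτ hn hu₁ hur₁).sup_mul one_ne_zero hu₂ hv₂)
  · exact Or.inl (((scalarFamilyBound_baseSpan.sup_inv hτ hn hu₁ hur₁).sup_inv hτ hn hu₂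
      hur₂).mono one_lt_two)

theorem five_le_of_computes (hτ : Irreducible (X ^ 2 + C τ : k[X])) (hn : 2 ≤ n) {Γ : Program k}
    {a b c d : InputFun τ n} (h : Γ.Computes a b c d) (ha : a ∈ baseSpan τ n)
    (hb : b ∈ baseSpan τ n)
    (hinv : ∀ W : Submodule k (InputFun τ n), c ∈ W → d ∈ W → invRe τ n ∈ W ∧ invIm τ n ∈ W) :
    5 ≤ Γ.muls + Γ.invs := by
  by_contra! hlt
  obtain ⟨t, ht, hc, hd⟩ := h
  obtain ⟨W, hW, htW⟩ := ht.exists_chain one_mem_baseSpan (by simpa using ⟨ha, hb⟩)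
  obtain ⟨hre, him⟩ := hinv W (htW _ (List.mem_of_getElem? hc)) (htW _ (List.mem_of_getElem? hd))
  obtain ⟨V₁, hstep₁, V₂, hstep₂, V₃, hstep₃, _, ⟨r, rfl, -⟩, rfl⟩ :=
    hW.mono one_mem_baseSpan (Nat.le_of_lt_succ hlt)
  obtain ⟨α, β, hαβ, hmem⟩ := exists_smul_add_smul_mem hre him
  rcases familyBound_of_two_steps hτ hn hstep₁ hstep₂ with h | h
  · exact h.invComb_notMem_of_step hτ hn hαβ hstep₃ hmem
  · exact h.invComb_notMem_of_step hτ hn hαβ hstep₃ hmem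

theorem five_le_muls_add_invs (hτ : Irreducible (X ^ 2 + C τ : k[X])) (hn : 2 ≤ n)
    {Γ : Program k} (h : Γ.InvertsOn (S₁ τ n) ∨ Γ.InvertsOn (S₂ τ n)) :
    5 ≤ Γ.muls + Γ.invs := by
  have hτ₀ := tau_ne_zero hτ
  rcases h with h | h
  · exact five_le_of_computes hτ hn h.computes_of_S₁ re_mem_baseSpan im_mem_baseSpan
      fun _ hc hd => ⟨hc, hd⟩
  · refine five_le_of_computes hτ hn (h.computes_of_S₂ hτ₀)
      (Submodule.smul_mem _ _ im_mem_baseSpan) re_mem_baseSpan fun W hc hd => ⟨?_, hc⟩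
    exact (W.smul_mem_iff (neg_ne_zero.mpr (inv_ne_zero hτ₀))).mp hd

end Frobenius

theorem mainTheorem1 {k : Type*} [Field k] (τ : k)
    (hτ : Irreducible (Polynomial.X ^ 2 + Polynomial.C τ : Polynomial k)) (n : ℕ) (hn : 2 ≤ n) :
    -- Frobenius inversion is correct on `S₁ ∪ S₂`, and each branch is correct on its whole domain
    (∀ Z ∈ Frobenius.S₁ τ n ∪ Frobenius.S₂ τ n, (Frobenius.frobeniusInversion τ Z).InvertsAt Z) ∧
    (Frobenius.frobenius₁ τ).InvertsOn (Frobenius.S₁ τ n) ∧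
    (Frobenius.frobenius₂ τ).InvertsOn (Frobenius.S₂ τ n) ∧
    -- on every input it performs two inversions, three multiplications and one addition
    (∀ Z : Matrix (Fin n) (Fin n) (Frobenius.QuadExt τ),
      (Frobenius.frobeniusInversion τ Z).invs = 2 ∧
      (Frobenius.frobeniusInversion τ Z).muls = 3 ∧
      (Frobenius.frobeniusInversion τ Z).adds = 1) ∧
    -- a straight-line program that inverts all of `S₁`, or all of `S₂` (in particular one that
    -- inverts all of `S₁ ∪ S₂`), needs as many multiplications and inversions in total, and as
    -- many additions
    (∀ Γ : Frobenius.Program k,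
      (Γ.InvertsOn (Frobenius.S₁ τ n) ∨ Γ.InvertsOn (Frobenius.S₂ τ n)) →
        5 ≤ Γ.muls + Γ.invs ∧ 1 ≤ Γ.adds) :=
  ⟨fun _ => Frobenius.frobeniusInversion_invertsAt, Frobenius.frobenius₁_invertsOn τ n,
    Frobenius.frobenius₂_invertsOn τ n, Frobenius.frobeniusInversion_cost τ,
    fun _ h => ⟨Frobenius.five_le_muls_add_invs hτ hn h,
      Frobenius.one_le_adds hτ (Nat.ne_zero_of_lt hn) h⟩⟩
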